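/- A deterministic visibly push-down automaton (DVPDA) consists of a finite set $Q$ of states, an input alphabet partitioned as $\Sigma=\Sigma_{\mathrm{call}}\cup\Sigma_{\mathrm{int}}\cup\Sigma_{\mathrm{ret}}$, a finite stack alphabet $\Gamma$ with a bottom symbol $\bot\in\Gamma$, and total transition functions $\delta_c\colon Q\times\Sigma_{\mathrm{call}}\to Q\times(\Gamma\setminus\{\bot\})$ (pushing one symbol), $\delta_i\colon Q\times\Sigma_{\mathrm{int}}\to Q$ (leaving the stack unchanged) and $\delta_r\colon Q\times\Sigma_{\mathrm{ret}}\times\Gamma\to Q$ (reading the top symbol of the stack and popping it, except that $\bot$ is read but never popped). It is a DVVPDA (very visibly) if the symbol pushed by $\delta_c(q,\sigma)$ depends only on $\sigma$, and a DVCA (visibly counter automaton) if $|\Gamma\setminus\{\bot\}|=1$. A word $w\in\Sigma^*$ synchronizes $M$ in the same stack model if there are a state $\bar q$ and a stack content $\upsilon$ such that for every $q\in Q$ the run of $w$ from the configuration $(q,\bot)$ ends in $(\bar q,\upsilon)$. An upstroke (downstroke) is a sequence of configurations in which no transition decreases (increases) the stack height, and a stroke is an upstroke or a downstroke. A word $w$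 is a $0$-turn synchronizing word for $M$ in the same stack model if it synchronizes $M$ in the same stack model and for every $q\in Q$ the run of $w$ from $(q,\bot)$ consists of at most one stroke. **Theorem.** For each of the classes DVPDA, DVVPDA and DVCA, the following problem is in $\mathsf{PSPACE}$: given an automaton $M$ of the class, does $M$ have a $0$-turn synchronizing word in the same stack model? Consequently, the following problem is in $\mathsf{PSPACE}$ too: given a DVPDA $M$ with $\Sigma_{\mathrm{ret}}=\emptyset$, does $M$ have a synchronizing word in the same stack model? Here automata are given as binary strings that list the sizes of $Q$, $\Sigma_{\mathrm{call}}$, $\Sigma_{\mathrm{int}}$, $\Sigma_{\mathrm{ret}}$, $\Gamma\setminus\{\bot\}$ and all transitions, with numbers in unary, and a problem is the language of the descriptions of its yes-instances. -/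

import Mathlib

/-! ### Deterministic visibly push-down automata -/

/-- An input letter of a visibly push-down automaton: the input alphabet is the disjoint union
of the call letters `C`, the internal letters `I` and the return letters `R`. -/
inductive VLetter (C I R : Type*) where
  | call (a : C)
  | int (a : I)
  | ret (a : R)

/-- A (complete, real-time) deterministic visibly push-down automaton without initial and final
states. `Q` is the set of states and `G` is the set of stack symbols other than the bottom
symbol `⊥`; the whole stack alphabet is `Option G`, where `none` is `⊥`. -/
structure DVPDA (Q C I R G : Type*) where
  /-- a call letter changes the state and pushes one symbol other than `⊥` -/
  callStep : Q → C → Q × G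
  /-- an internal letter changes the state only -/
  intStep : Q → I → Q
  /-- a return letter reads the symbol on top of the stack, which is popped unless it is `⊥` -/
  retStep : Q → R → Option G → Q

namespace DVPDA

variable {Q C I R G : Type*}

/-- One transition. A configuration `(q, s)` consists of the state `q` and the list `s` of the
stack symbols above `⊥`, topmost symbol first (`⊥` is always present and never moves, so it is
not recorded). -/
def step (M : DVPDA Q C I R G) : Q × List G → VLetter C I R → Q × List G
  | (q, s), .call a => ((M.callStep q a).1, (M.callStep q a).2 :: s)
  | (q, s), .int a => (M.intStep q a, s)
  | (q, []), .ret a => (M.retStep q a none, [])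
  | (q, g :: s), .ret a => (M.retStep q a (some g), s)

/-- The configuration that is reached from `c` by reading the word `w`. -/
def run (M : DVPDA Q C I R G) (c : Q × List G) (w : List (VLetter C I R)) : Q × List G :=
  w.foldl M.step c

/-- No transition of the run of `w` from `c` decreases the stack height. -/
def IsUpstroke (M : DVPDA Q C I R G) (c : Q × List G) (w : List (VLetter C I R)) : Prop :=
  ∀ u a v, w = u ++ a :: v → (M.run c u).2.length ≤ (M.run c (u ++ [a])).2.length

/-- No transition of the run of `w` from `c` increases the stack height. -/
def IsDownstroke (M : DVPDA Q C I R G) (c : Q × List G) (w : List (VLetter C I R)) : Prop :=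
  ∀ u a v, w = u ++ a :: v → (M.run c (u ++ [a])).2.length ≤ (M.run c u).2.length

/-- A stroke is an upstroke or a downstroke. -/
def IsStroke (M : DVPDA Q C I R G) (c : Q × List G) (w : List (VLetter C I R)) : Prop :=
  M.IsUpstroke c w ∨ M.IsDownstroke c w

/-- The run of `w` from `c` consists of at most `k` strokes (a stroke may be empty, so cutting
the run into exactly `k` strokes is the same as cutting it into at most `k` strokes). -/
def AtMostStrokes (M : DVPDA Q C I R G) :
    ℕ → Q × List G → List (VLetter C I R) → Prop
  | 0, _, w => w = []
  | k + 1, c, w => ∃ u v, w = u ++ v ∧ M.IsStroke c u ∧ M.AtMostStrokes k (M.run c u) v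

/-- `w` synchronizes `M` in the same stack model: the runs of `w` from all states, started with
the empty stack, end in one common state with one common stack content. -/
def SyncSame (M : DVPDA Q C I R G) (w : List (VLetter C I R)) : Prop :=
  ∃ (p : Q) (s : List G), ∀ q : Q, M.run (q, []) w = (p, s)

/-- `w` is an `n`-turn synchronizing word for `M` in the same stack model: it synchronizes `M` in
the same stack model, and each run of `w` from a state with empty stack consists of at most
`n + 1` strokes. -/
def TurnSyncSame (M : DVPDA Q C I R G) (n : ℕ) (w : List (VLetter C I R)) : Prop :=
  M.SyncSame w ∧ ∀ q : Q, M.AtMostStrokes (n + 1) (q, []) w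

/-- `M` is a deterministic very visibly push-down automaton (DVVPDA): the pushed symbol depends
on the call letter only. -/
def IsVeryVisibly (M : DVPDA Q C I R G) : Prop :=
  ∀ (a : C) (p q : Q), (M.callStep p a).2 = (M.callStep q a).2

/-- `M` is a deterministic visibly (one) counter automaton (DVCA): there is exactly one stack
symbol other than `⊥`. -/
def IsCounter (_M : DVPDA Q C I R G) : Prop :=
  Nat.card G = 1

/-- `M` has no return letter. -/
def NoReturn (_M : DVPDA Q C I R G) : Prop :=
  IsEmpty R

end DVPDA

/-! ### Encoding of automata as binary strings -/

/-- A finite DVPDA in numbered form, as it is given to a Turing machine. -/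
structure CodedDVPDA where
  (nQ nC nI nR nG : ℕ)
  aut : DVPDA (Fin nQ) (Fin nC) (Fin nI) (Fin nR) (Fin nG)

/-- A list of natural numbers as a binary string, the number `k` being written as `1…10`. -/
def encodeNums (l : List ℕ) : List Bool :=
  l.flatMap fun k => List.replicate k true ++ [false]

namespace CodedDVPDA

/-- The description of an automaton: the sizes of its five components, followed by its
transition tables. The numbers below are written in unary, so that the length of a description
is polynomially related to the numbers of states, letters and stack symbols. -/
def toNums (M : CodedDVPDA) : List ℕ :=
  [M.nQ, M.nC, M.nI, M.nR, M.nG] ++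
  ((List.finRange M.nQ).flatMap fun q => (List.finRange M.nC).flatMap fun a =>
    [((M.aut.callStep q a).1 : ℕ), ((M.aut.callStep q a).2 : ℕ)]) ++
  ((List.finRange M.nQ).flatMap fun q => (List.finRange M.nI).map fun a =>
    (M.aut.intStep q a : ℕ)) ++
  ((List.finRange M.nQ).flatMap fun q => (List.finRange M.nR).flatMap fun a =>
    (M.aut.retStep q a none : ℕ) ::
      (List.finRange M.nG).map fun g => (M.aut.retStep q a (some g) : ℕ))

/-- The binary string that describes an automaton. -/
def encode (M : CodedDVPDA) : List Bool :=
  encodeNums M.toNums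

theorem encodeNums_injective : Function.Injective encodeNums := by
  have key : ∀ (a b : ℕ) (x y : List Bool),
      List.replicate a true ++ false :: x = List.replicate b true ++ false :: y →
        a = b ∧ x = y := by
    intro a
    induction a with
    | zero => intro b x y h; cases b <;> simp_all [List.replicate_succ]
    | succ a ih =>
      intro b x y h
      cases b with
      | zero => simp [List.replicate_succ] at h
      | succ b =>
        simp only [List.replicate_succ, List.cons_append, List.cons.injEq, true_and] at h
        simpa using ih b x y h
  intro l
  induction l with
  | nil => intro m h; cases m <;> simp_all [encodeNums]
  | cons a l ih =>
    intro m h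
    cases m with
    | nil => simp [encodeNums] at h
    | cons b m =>
      simp only [encodeNums, List.flatMap_cons, List.append_assoc, List.singleton_append] at h
      obtain ⟨h1, h2⟩ := key _ _ _ _ h
      rw [h1, ih h2]

theorem flatMap_inj {α β : Type*} {f g : α → List β} (hl : ∀ x, (f x).length = (g x).length)
    {l : List α} (h : l.flatMap f = l.flatMap g) : ∀ x ∈ l, f x = g x := by
  induction l with
  | nil => simp
  | cons a l ih =>
    simp only [List.flatMap_cons] at h
    obtain ⟨h1, h2⟩ := List.append_inj h (hl a)
    simpa [h1] using ih h2

/-- A description determines the automaton. -/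
theorem encode_injective : Function.Injective encode := by
  rintro ⟨q, c, i, r, g, M⟩ ⟨q', c', i', r', g', M'⟩ h
  have h := encodeNums_injective h
  simp only [toNums, List.cons_append, List.nil_append, List.cons.injEq] at h
  obtain ⟨rfl, rfl, rfl, rfl, rfl, h⟩ := h
  obtain ⟨h, h3⟩ := List.append_inj h (by simp [List.length_flatMap])
  obtain ⟨h1, h2⟩ := List.append_inj h (by simp [List.length_flatMap])
  congr 1
  obtain ⟨c1, i1, r1⟩ := M
  obtain ⟨c2, i2, r2⟩ := M'
  congr 1
  · funext p a
    have := flatMap_inj (by simp) (flatMap_inj (by simp) h1 p (List.mem_finRange p)) a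
      (List.mem_finRange a)
    simp only [List.cons.injEq, Fin.val_inj, and_true] at this
    exact Prod.ext this.1 this.2
  · funext p a
    have := List.map_inj_left.1 (flatMap_inj (by simp) h2 p (List.mem_finRange p)) a
      (List.mem_finRange a)
    exact Fin.ext this
  · funext p a o
    have := flatMap_inj (by simp) (flatMap_inj (by simp) h3 p (List.mem_finRange p)) a
      (List.mem_finRange a)
    simp only [List.cons.injEq, Fin.val_inj] at this
    cases o with
    | none => exact this.1
    | some b => exact Fin.ext (List.map_inj_left.1 this.2 b (List.mem_finRange b))

end CodedDVPDA

/-! ### The decision problems, as languages of binary strings -/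

/-- `n`-Turn-Sync-DVPDA-Same, restricted to the automata in the class `P`: all descriptions of
automata in `P` that have an `n`-turn synchronizing word in the same stack model. -/
def TurnSyncSameProblem (n : ℕ) (P : CodedDVPDA → Prop) : Language Bool :=
  {x | ∃ M : CodedDVPDA, P M ∧ M.encode = x ∧ ∃ w, M.aut.TurnSyncSame n w}

/-- Sync-DVPDA-Same, restricted to the automata in the class `P`: all descriptions of automata
in `P` that have a synchronizing word in the same stack model. -/
def SyncSameProblem (P : CodedDVPDA → Prop) : Language Bool :=
  {x | ∃ M : CodedDVPDA, P M ∧ M.encode = x ∧ ∃ w, M.aut.SyncSame w}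

/-! ### Polynomial space -/

/-- The space that a configuration of a multi-stack Turing machine occupies: the total number
of symbols on its stacks (the stack that holds the input is counted as well). -/
def Turing.FinTM2.space (tm : Turing.FinTM2) (c : tm.Cfg) : ℕ :=
  letI := tm.kFin
  ∑ k : tm.K, (c.stk k).length

open Classical in
/-- The class PSPACE: `L` is decided by a deterministic Turing machine that halts on every
input, with output `true` or `false`, and that on an input of length `n` visits only
configurations of size at most `p n`, for some polynomial `p`. All stack alphabets of the machine
have to be finite. -/
def InPSPACE {α : Type} (L : Language α) : Prop :=
  ∃ (M : Turing.TM2Computable (id : List α → List α) Computability.encodeBool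
      (fun x => decide (x ∈ L))) (p : Polynomial ℕ),
    (∀ k, Finite (M.tm.Γ k)) ∧
    ∀ (x : List α) (c : M.tm.Cfg),
      StateTransition.Reaches M.tm.step
        (Turing.initList M.tm (x.map M.inputAlphabet.invFun)) c →
      M.tm.space c ≤ p.eval x.length

open Function

/-! ### Bijective binary numerals -/

/-! Combinatorial core. A downstroke that starts with empty stack never leaves it and so is an
upstroke too; hence only upstrokes matter. Along an upstroke from the empty stack, return letters
can occur only while the stack is empty, that is, before the first call letter. So the word splits
into a flat phase, in which every run keeps the empty stack, and a rising phase without return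
letters, in which nothing pushed is ever removed. In the rising phase all runs push at the same
moments, so their final stacks agree exactly if every call letter pushes the same symbol in all of
them. Thus a 0-turn synchronizing word exists if and only if, in the graph of subsets of `Q`, the
full set leads by edges of type `FlatEdge` to some set `U`, and `U` leads by edges of type
`RiseEdge` to a singleton (`exists_turnSyncSame_zero_iff`). Without return letters every run is an
upstroke, which gives the last problem.

Complexity. The graph has `2 ^ |Q|` vertices, which are numbers of `|Q|` bits, and its edges are
easy to test. Savitch's recursion decides reachability in polynomial space; it is run as an
iteration on an explicit stack that is itself a number (`savitchRun`, `SavitchInv.step`,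
`PSP.reflTransGen`).

Machine model. Space bounds are proved for while programs on natural numbers whose values have at
most `B` bits. `Prog.exists_code` compiles them to stack machines with one stack per variable and
one auxiliary stack, and `Prog.inPSPACE` concludes. Values are stored as bijective binary numerals,
for which every bit string is the numeral of exactly one number, so the input word is a number
without any conversion. On top of this, `PS` and `PSP` are the polynomial-space functions and
predicates. As time is free, their closure properties are obtained by brute force: counting loops,
search below exponential bounds, and computing a function by searching its graph. -/

/-- The number with the bijective binary numeral `l`, least significant digit first; `false` is
the digit 1 and `true` is the digit 2. -/
def numeralVal : List Bool → ℕ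
  | [] => 0
  | b :: l => (if b then 2 else 1) + 2 * numeralVal l

/-- Successor of bijective binary numerals. -/
def numeralSucc : List Bool → List Bool
  | [] => [false]
  | false :: l => true :: l
  | true :: l => false :: numeralSucc l

/-- The predecessor of `l`, preceded by `j` digits 2 that stand for borrows. -/
def numeralPredAux : ℕ → List Bool → List Bool
  | j, [] => List.replicate (j - 1) true
  | j, false :: l => numeralPredAux (j + 1) l
  | j, true :: l => List.replicate j true ++ false :: l

/-- The bijective binary numeral of a number. -/
def numeral : ℕ → List Bool
  | 0 => []
  | n + 1 => numeralSucc (numeral n)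

theorem numeralVal_numeralSucc (l : List Bool) :
    numeralVal (numeralSucc l) = numeralVal l + 1 := by
  induction l with
  | nil => rfl
  | cons b l ih => cases b <;> simp [numeralSucc, numeralVal, ih] <;> omega

theorem numeralVal_numeral (n : ℕ) : numeralVal (numeral n) = n := by
  induction n with
  | zero => rfl
  | succ n ih => rw [numeral, numeralVal_numeralSucc, ih]

theorem numeralVal_injective : Function.Injective numeralVal := by
  intro l
  induction l with
  | nil => intro m h; cases m with
    | nil => rfl
    | cons b m => cases b <;> simp [numeralVal] at h <;> omega
  | cons b l ih =>
    intro m h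
    cases m with
    | nil => cases b <;> simp [numeralVal] at h
    | cons c m =>
      cases b <;> cases c <;> simp [numeralVal] at h ⊢ <;> first | exact ih h | omega

theorem numeral_numeralVal (l : List Bool) : numeral (numeralVal l) = l :=
  numeralVal_injective (numeralVal_numeral _)

/-- The extreme case is a numeral with all digits 1; for `numeralVal_add_two_le` it is all digits 2.
Together they show that the length of a numeral and the number of bits of its value differ by at
most one. -/
theorem two_pow_length_le (l : List Bool) : 2 ^ l.length ≤ numeralVal l + 1 := by
  induction l with
  | nil => simp [numeralVal]
  | cons b l ih => cases b <;> simp [numeralVal, pow_succ] <;> omega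

theorem numeralVal_add_two_le (l : List Bool) : numeralVal l + 2 ≤ 2 ^ (l.length + 1) := by
  induction l with
  | nil => simp [numeralVal]
  | cons b l ih =>
    rw [List.length_cons, pow_succ]
    cases b <;> simp only [numeralVal] <;> split_ifs <;> omega

theorem length_numeral_le {n B : ℕ} (h : n < 2 ^ B) : (numeral n).length ≤ B := by
  have h1 := two_pow_length_le (numeral n)
  rw [numeralVal_numeral] at h1
  exact (Nat.pow_le_pow_iff_right (by norm_num : 1 < 2)).1 (h1.trans h)

/-- Each carry of the successor turns a digit 2 into a digit 1, and the predecessor undoes it by a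
borrow; `j` counts the borrows so far, which the induction needs. -/
theorem numeralPredAux_numeralSucc (l : List Bool) (j : ℕ) :
    numeralPredAux j (numeralSucc l) = List.replicate j true ++ l := by
  induction l generalizing j with
  | nil => simp [numeralSucc, numeralPredAux]
  | cons b l ih =>
    cases b
    · simp [numeralSucc, numeralPredAux]
    · simp [numeralSucc, numeralPredAux, ih, List.replicate_succ']

theorem numeralPredAux_numeral (n : ℕ) : numeralPredAux 0 (numeral n) = numeral (n - 1) := by
  cases n with
  | zero => rfl
  | succ n => simp [numeral, numeralPredAux_numeralSucc]

theorem numeral_eq_nil {n : ℕ} : numeral n = [] ↔ n = 0 := by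
  constructor
  · intro h; rw [← numeralVal_numeral n, h]; rfl
  · rintro rfl; rfl

/-! ### While programs -/

/-- Programs with variables `0, 1, 2, …` that hold natural numbers. -/
inductive Prog
  | inc (x : ℕ)
  | dec (x : ℕ)
  | seq (P Q : Prog)
  | ite (x : ℕ) (P Q : Prog)
  | loop (x : ℕ) (P : Prog)

namespace Prog

/-- Big-step semantics: the program leads from the first to the second assignment, and no variable
is ever set to a value of more than `B` bits. -/
inductive Exec (B : ℕ) : Prog → (ℕ → ℕ) → (ℕ → ℕ) → Prop
  | inc {x s} (h : s x + 1 < 2 ^ B) : Exec B (inc x) s (update s x (s x + 1))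
  | dec {x s} : Exec B (dec x) s (update s x (s x - 1))
  | seq {P Q s t u} (h₁ : Exec B P s t) (h₂ : Exec B Q t u) : Exec B (seq P Q) s u
  | ite_pos {x P Q s t} (hx : s x ≠ 0) (h : Exec B P s t) : Exec B (ite x P Q) s t
  | ite_neg {x P Q s t} (hx : s x = 0) (h : Exec B Q s t) : Exec B (ite x P Q) s t
  | loop_done {x P s} (hx : s x = 0) : Exec B (loop x P) s s
  | loop_step {x P s t u} (hx : s x ≠ 0) (h₁ : Exec B P s t) (h₂ : Exec B (loop x P) t u) :
      Exec B (loop x P) s u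

/-- `Exec` checks the bound at increments only; no other command enlarges a value. -/
theorem Exec.lt {B : ℕ} {P : Prog} {s t : ℕ → ℕ} (h : Exec B P s t) (hs : ∀ j, s j < 2 ^ B) :
    ∀ j, t j < 2 ^ B := by
  induction h with
  | inc h =>
    intro j; rw [update_apply]; split_ifs
    exacts [h, hs j]
  | @dec x s =>
    intro j; rw [update_apply]; split_ifs
    exacts [(Nat.sub_le _ _).trans_lt (hs x), hs j]
  | seq _ _ ih₁ ih₂ => exact ih₂ (ih₁ hs)
  | ite_pos _ _ ih => exact ih hs
  | ite_neg _ _ ih => exact ih hs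
  | loop_done => exact hs
  | loop_step _ _ _ ih₁ ih₂ => exact ih₂ (ih₁ hs)

/-- All variables of the program are less than `N`. -/
def Below (N : ℕ) : Prog → Prop
  | inc x => x < N
  | dec x => x < N
  | seq P Q => P.Below N ∧ Q.Below N
  | ite x P Q => x < N ∧ P.Below N ∧ Q.Below N
  | loop x P => x < N ∧ P.Below N

theorem Below.mono {N N' : ℕ} (h : N ≤ N') {P : Prog} (hP : P.Below N) : P.Below N' := by
  induction P with
  | inc x => exact lt_of_lt_of_le hP h
  | dec x => exact lt_of_lt_of_le hP h
  | seq P Q ihP ihQ => exact ⟨ihP hP.1, ihQ hP.2⟩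
  | ite x P Q ihP ihQ => exact ⟨hP.1.trans_le h, ihP hP.2.1, ihQ hP.2.2⟩
  | loop x P ih => exact ⟨hP.1.trans_le h, ih hP.2⟩

theorem exists_below (P : Prog) : ∃ N, P.Below N := by
  induction P with
  | inc x => exact ⟨x + 1, Nat.lt_succ_self x⟩
  | dec x => exact ⟨x + 1, Nat.lt_succ_self x⟩
  | seq P Q ihP ihQ =>
    obtain ⟨a, ha⟩ := ihP
    obtain ⟨b, hb⟩ := ihQ
    exact ⟨max a b, ha.mono (le_max_left _ _), hb.mono (le_max_right _ _)⟩
  | ite x P Q ihP ihQ =>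
    obtain ⟨a, ha⟩ := ihP
    obtain ⟨b, hb⟩ := ihQ
    exact ⟨max (x + 1) (max a b), lt_of_lt_of_le (Nat.lt_succ_self x) (le_max_left _ _),
      ha.mono (by omega), hb.mono (by omega)⟩
  | loop x P ih =>
    obtain ⟨a, ha⟩ := ih
    exact ⟨max (x + 1) a, lt_of_lt_of_le (Nat.lt_succ_self x) (le_max_left _ _),
      ha.mono (by omega)⟩

/-! ### Compilation of while programs to stack machines -/

/-- Statements of the machine for programs with variables less than `N`: stack `x + 1` holds the
numeral of the variable `x`, stack `0` is auxiliary. -/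
abbrev MStmt (N : ℕ) (Λ : Type) := Turing.TM2.Stmt (fun _ : Fin (N + 1) => Bool) Λ (Option Bool)

/-- Configurations of the machine. -/
abbrev MCfg (N : ℕ) (Λ : Type) := Turing.TM2.Cfg (fun _ : Fin (N + 1) => Bool) Λ (Option Bool)

/-- The stacks that represent an assignment. -/
def stackOf (N : ℕ) (s : ℕ → ℕ) : Fin (N + 1) → List Bool :=
  Fin.cons [] fun i : Fin N => numeral (s i)

/-- All stacks hold at most `B` symbols. -/
def Small {N : ℕ} {Λ : Type} (B : ℕ) (c : MCfg N Λ) : Prop :=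
  ∀ k, (c.stk k).length ≤ B

/-- The machine leads from one configuration to another, and all configurations before the
last one are small. -/
def Path {N : ℕ} {Λ : Type} (M : Λ → MStmt N Λ) (B : ℕ) : MCfg N Λ → MCfg N Λ → Prop :=
  Relation.ReflTransGen fun c c' => Small B c ∧ Turing.TM2.step M c = some c'

/-- The stack of the variable `x`. -/
def key {N x : ℕ} (h : x < N) : Fin (N + 1) :=
  Fin.succ ⟨x, h⟩

theorem key_ne_zero {N x : ℕ} (h : x < N) : key h ≠ 0 :=
  Fin.succ_ne_zero _

@[simp]
theorem stackOf_key {N x : ℕ} (h : x < N) (s : ℕ → ℕ) : stackOf N s (key h) = numeral (s x) :=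
  rfl

theorem update_stackOf_zero (N : ℕ) (s : ℕ → ℕ) : update (stackOf N s) 0 [] = stackOf N s :=
  update_eq_self_iff.2 rfl

theorem stackOf_update {N x : ℕ} (h : x < N) (s : ℕ → ℕ) (v : ℕ) :
    stackOf N (update s x v) = update (stackOf N s) (key h) (numeral v) := by
  funext k
  refine Fin.cases ?_ (fun i => ?_) k
  · rw [update_of_ne (key_ne_zero h).symm]; rfl
  · by_cases hi : i = ⟨x, h⟩
    · subst hi; rw [show Fin.succ ⟨x, h⟩ = key h from rfl]; simp
    · have : (i : ℕ) ≠ x := fun e => hi (Fin.ext e)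
      rw [update_of_ne (show Fin.succ i ≠ key h from fun e => hi (Fin.succ_injective _ e))]
      simp [stackOf, update_of_ne this]

theorem length_stackOf_le {N B : ℕ} {s : ℕ → ℕ} (hs : ∀ j, s j < 2 ^ B) (k : Fin (N + 1)) :
    (stackOf N s k).length ≤ B := by
  refine Fin.cases ?_ (fun i => ?_) k
  · simp [stackOf]
  · simpa [stackOf] using length_numeral_le (hs i)

variable {N : ℕ} {Λ : Type}

open Turing.TM2.Stmt in
/-- Increment: phase `true` moves the trailing digits 2 to the auxiliary stack, phase `false`
puts digits 1 in their place. -/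
def incCode (k : Fin (N + 1)) (ι : Bool → Λ) (exit : Λ) : Bool → MStmt N Λ
  | true => pop k (fun _ o => o) <| branch (fun v => v == some true)
      (push 0 (fun _ => true) <| load (fun _ => none) <| goto fun _ => ι true) <|
      branch (fun v => v == some false)
        (push k (fun _ => true) <| load (fun _ => none) <| goto fun _ => ι false)
        (push k (fun _ => false) <| load (fun _ => none) <| goto fun _ => ι false)
  | false => pop 0 (fun _ o => o) <| branch (fun v => v.isSome)
      (push k (fun _ => false) <| load (fun _ => none) <| goto fun _ => ι false)
      (load (fun _ => none) <| goto fun _ => exit)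

open Turing.TM2.Stmt in
/-- Decrement: phase `true` moves the trailing digits 1 to the auxiliary stack, phase `false`
puts digits 2 in their place. -/
def decCode (k : Fin (N + 1)) (ι : Bool → Λ) (exit : Λ) : Bool → MStmt N Λ
  | true => pop k (fun _ o => o) <| branch (fun v => v == some false)
      (push 0 (fun _ => true) <| load (fun _ => none) <| goto fun _ => ι true) <|
      branch (fun v => v == some true)
        (push k (fun _ => false) <| load (fun _ => none) <| goto fun _ => ι false)
        (pop 0 (fun _ _ => none) <| goto fun _ => ι false)
  | false => pop 0 (fun _ o => o) <| branch (fun v => v.isSome)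
      (push k (fun _ => true) <| load (fun _ => none) <| goto fun _ => ι false)
      (load (fun _ => none) <| goto fun _ => exit)

theorem small_update {B : ℕ} {l : Option Λ} {v : Option Bool} {S : Fin (N + 1) → List Bool}
    {k : Fin (N + 1)} {a b : List Bool} (hS : ∀ k, (S k).length ≤ B) (ha : a.length ≤ B)
    (hb : b.length ≤ B) : Small B (⟨l, v, update (update S k a) 0 b⟩ : MCfg N Λ) := by
  intro i
  simp only [update_apply]
  split_ifs
  exacts [hb, ha, hS i]

/-- A loop that puts `j` digits `d` back on the stack `k`. -/
theorem path_restore {M : Λ → MStmt N Λ} {l exit : Λ} {k : Fin (N + 1)} (hk : k ≠ 0) {d : Bool}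
    (hM : M l = .pop 0 (fun _ o => o) (.branch (fun v => v.isSome)
      (.push k (fun _ => d) <| .load (fun _ => none) <| .goto fun _ => l)
      (.load (fun _ => none) <| .goto fun _ => exit)))
    {B : ℕ} {S : Fin (N + 1) → List Bool} (hS : ∀ k, (S k).length ≤ B) (j : ℕ) (a : List Bool)
    (h : j + a.length ≤ B) :
    Path M B ⟨some l, none, update (update S k a) 0 (List.replicate j true)⟩
      ⟨some exit, none, update (update S k (List.replicate j d ++ a)) 0 []⟩ := by
  induction j generalizing a with
  | zero =>
    refine .single ⟨small_update hS (by omega) (by simp), ?_⟩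
    simp [hM]
  | succ j ih =>
    have h2 : List.replicate (j + 1) d ++ a = List.replicate j d ++ d :: a := by
      simp [List.replicate_succ']
    rw [h2]
    refine .head ⟨small_update hS (by omega) (by simp; omega), ?_⟩ (ih (d :: a) (by simp; omega))
    simp only [Turing.TM2.step, hM, Turing.TM2.stepAux, Option.some.injEq, List.replicate_succ,
      update_self, List.head?_cons, Option.isSome_some, cond_true, List.tail_cons, update_idem,
      update_of_ne hk]
    congr 1
    rw [update_comm hk.symm, update_idem, update_comm hk]

/-- Here `j` counts the trailing digits 2 already moved to the auxiliary stack; once the carry is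
absorbed they come back as digits 1. `path_decCode` is the mirror image. -/
theorem path_incCode {M : Λ → MStmt N Λ} {ι : Bool → Λ} {exit : Λ} {k : Fin (N + 1)} (hk : k ≠ 0)
    (hM : ∀ l, M (ι l) = incCode k ι exit l)
    {B : ℕ} {S : Fin (N + 1) → List Bool} (hS : ∀ k, (S k).length ≤ B) (a : List Bool) (j : ℕ)
    (h : j + a.length + 1 ≤ B) :
    Path M B ⟨some (ι true), none, update (update S k a) 0 (List.replicate j true)⟩
      ⟨some exit, none, update (update S k (List.replicate j false ++ numeralSucc a)) 0 []⟩ := by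
  induction a generalizing j with
  | nil =>
    refine .head ⟨small_update hS (by simp) (by simp at h ⊢; omega), ?_⟩
      (path_restore hk (hM false) hS j [false] (by simpa using h))
    simp only [Turing.TM2.step, hM, incCode, Turing.TM2.stepAux, Option.some.injEq]
    simp [update_of_ne hk, update_comm hk]
  | cons b a ih =>
    simp only [List.length_cons] at h
    cases b
    · refine .head ⟨small_update hS (by simp; omega) (by simp; omega), ?_⟩
        (path_restore hk (hM false) hS j (true :: a) (by simp; omega))
      simp only [Turing.TM2.step, hM, incCode, Turing.TM2.stepAux, Option.some.injEq]
      simp [update_of_ne hk, update_comm hk]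
    · have h2 : List.replicate j false ++ numeralSucc (true :: a) =
          List.replicate (j + 1) false ++ numeralSucc a := by
        simp [List.replicate_succ', numeralSucc]
      rw [h2]
      refine .head ⟨small_update hS (by simp; omega) (by simp; omega), ?_⟩ (ih (j + 1) (by omega))
      simp only [Turing.TM2.step, hM, incCode, Turing.TM2.stepAux, Option.some.injEq]
      simp [update_of_ne hk, update_comm hk, update_of_ne hk.symm, List.replicate_succ]

theorem path_decCode {M : Λ → MStmt N Λ} {ι : Bool → Λ} {exit : Λ} {k : Fin (N + 1)} (hk : k ≠ 0)
    (hM : ∀ l, M (ι l) = decCode k ι exit l)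
    {B : ℕ} {S : Fin (N + 1) → List Bool} (hS : ∀ k, (S k).length ≤ B) (a : List Bool) (j : ℕ)
    (h : j + a.length ≤ B) :
    Path M B ⟨some (ι true), none, update (update S k a) 0 (List.replicate j true)⟩
      ⟨some exit, none, update (update S k (numeralPredAux j a)) 0 []⟩ := by
  induction a generalizing j with
  | nil =>
    -- When a borrow runs off the end, the leading digit disappears, so one of the `j` marks is
    -- discarded; for `j = 0` this is the truncated predecessor of zero.
    have := path_restore hk (hM false) hS (j - 1) [] (by simp at h ⊢; omega)
    rw [List.append_nil] at this
    refine .head ⟨small_update hS (by simp) (by simp at h ⊢; omega), ?_⟩ this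
    simp only [Turing.TM2.step, hM, decCode, Turing.TM2.stepAux, Option.some.injEq]
    simp [update_of_ne hk, update_comm hk, update_of_ne hk.symm]
  | cons b a ih =>
    simp only [List.length_cons] at h
    cases b
    · refine .head ⟨small_update hS (by simp; omega) (by simp; omega), ?_⟩ (ih (j + 1) (by omega))
      simp only [Turing.TM2.step, hM, decCode, Turing.TM2.stepAux, Option.some.injEq]
      simp [update_of_ne hk, update_comm hk, update_of_ne hk.symm, List.replicate_succ]
    · refine .head ⟨small_update hS (by simp; omega) (by simp; omega), ?_⟩
        (path_restore hk (hM false) hS j (false :: a) (by simp; omega))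
      simp only [Turing.TM2.step, hM, decCode, Turing.TM2.stepAux, Option.some.injEq]
      simp [update_of_ne hk, update_comm hk]

/-- The statement at label `l` of a machine fragment with labels `L`, where `ι` embeds `L` into the
labels of the machine and `exit` is the label to go to afterwards, such that the fragment
simulates `P`. -/
theorem exists_code (P : Prog) (hP : P.Below N) :
    ∃ (L : Type) (_ : Fintype L) (entry : L)
      (code : ∀ {Λ : Type}, (L → Λ) → Λ → L → MStmt N Λ),
      ∀ {Λ : Type} (M : Λ → MStmt N Λ) (ι : L → Λ) (exit : Λ), (∀ l, M (ι l) = code ι exit l) →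
        ∀ {B : ℕ} {s t : ℕ → ℕ}, Exec B P s t → (∀ j, s j < 2 ^ B) →
          Path M (B + 1) ⟨some (ι entry), none, stackOf N s⟩ ⟨some exit, none, stackOf N t⟩ := by
  induction P with
  | inc x =>
    replace hP : x < N := hP
    refine ⟨Bool, inferInstance, true, incCode (key hP), ?_⟩
    intro Λ M ι exit hM B s t h hs
    cases h with
    | inc h =>
      -- `path_incCode` reserves a symbol for a carry that lengthens the numeral, hence `B + 1`.
      have := path_incCode (key_ne_zero hP) hM (B := B + 1) (S := stackOf N s)
        (fun k => (length_stackOf_le hs k).trans (Nat.le_succ _)) (numeral (s x)) 0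
        (by have := length_numeral_le (hs x); omega)
      rwa [List.replicate_zero, List.replicate_zero, List.nil_append,
        show numeralSucc (numeral (s x)) = numeral (s x + 1) from rfl,
        ← stackOf_update, ← stackOf_update, update_eq_self, update_stackOf_zero,
        update_stackOf_zero] at this
  | dec x =>
    replace hP : x < N := hP
    refine ⟨Bool, inferInstance, true, decCode (key hP), ?_⟩
    intro Λ M ι exit hM B s t h hs
    cases h with
    | dec =>
      have := path_decCode (key_ne_zero hP) hM (B := B + 1) (S := stackOf N s)
        (fun k => (length_stackOf_le hs k).trans (Nat.le_succ _)) (numeral (s x)) 0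
        (by have := length_numeral_le (hs x); omega)
      rwa [List.replicate_zero, numeralPredAux_numeral, ← stackOf_update, ← stackOf_update,
        update_eq_self, update_stackOf_zero, update_stackOf_zero] at this
  | seq P Q ihP ihQ =>
    obtain ⟨L₁, _, e₁, c₁, h₁⟩ := ihP hP.1
    obtain ⟨L₂, _, e₂, c₂, h₂⟩ := ihQ hP.2
    refine ⟨L₁ ⊕ L₂, inferInstance, .inl e₁, fun ι exit l => match l with
      | .inl l => c₁ (ι ∘ .inl) (ι (.inr e₂)) l
      | .inr l => c₂ (ι ∘ .inr) exit l, ?_⟩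
    intro Λ M ι exit hM B s t h hs
    cases h with
    | seq ha hb =>
      exact (h₁ M _ _ (fun l => hM (.inl l)) ha hs).trans
        (h₂ M _ _ (fun l => hM (.inr l)) hb (ha.lt hs))
  | ite x P Q ihP ihQ =>
    obtain ⟨L₁, _, e₁, c₁, h₁⟩ := ihP hP.2.1
    obtain ⟨L₂, _, e₂, c₂, h₂⟩ := ihQ hP.2.2
    refine ⟨Option (L₁ ⊕ L₂), inferInstance, none, fun ι exit l => match l with
      | none => .peek (key hP.1) (fun _ o => o) <| .branch (fun v => v.isSome)
          (.load (fun _ => none) <| .goto fun _ => ι (some (.inl e₁)))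
          (.load (fun _ => none) <| .goto fun _ => ι (some (.inr e₂)))
      | some (.inl l) => c₁ (ι ∘ some ∘ .inl) exit l
      | some (.inr l) => c₂ (ι ∘ some ∘ .inr) exit l, ?_⟩
    intro Λ M ι exit hM B s t h hs
    have hsm (l : Option Λ) : Small (B + 1) (⟨l, none, stackOf N s⟩ : MCfg N Λ) :=
      fun k => (length_stackOf_le hs k).trans (Nat.le_succ _)
    cases h with
    | ite_pos hx h =>
      refine .head ⟨hsm _, ?_⟩ (h₁ M _ _ (fun l => hM (some (.inl l))) h hs)
      have hx' : numeral (s x) ≠ [] := fun e => hx (numeral_eq_nil.1 e)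
      obtain ⟨b, l, hbl⟩ := List.exists_cons_of_ne_nil hx'
      simp [Turing.TM2.step, hM none, hbl]
    | ite_neg hx h =>
      refine .head ⟨hsm _, ?_⟩ (h₂ M _ _ (fun l => hM (some (.inr l))) h hs)
      simp [Turing.TM2.step, hM none, numeral_eq_nil.2 hx]
  | loop x P ih =>
    obtain ⟨L, _, e, c, h⟩ := ih hP.2
    refine ⟨Option L, inferInstance, none, fun ι exit l => match l with
      | none => .peek (key hP.1) (fun _ o => o) <| .branch (fun v => v.isSome)
          (.load (fun _ => none) <| .goto fun _ => ι (some e))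
          (.load (fun _ => none) <| .goto fun _ => exit)
      | some l => c (ι ∘ some) (ι none) l, ?_⟩
    intro Λ M ι exit hM B s t hst hs
    generalize hR : Prog.loop x P = R at hst
    induction hst with
    | inc | dec | seq | ite_pos | ite_neg => cases hR
    | @loop_done x P s hx =>
      cases hR
      refine .single ⟨fun k => (length_stackOf_le hs k).trans (Nat.le_succ _), ?_⟩
      simp [Turing.TM2.step, hM none, numeral_eq_nil.2 hx]
    | @loop_step x P s t u hx ha hb iha ihb =>
      cases hR
      refine .head ⟨fun k => (length_stackOf_le hs k).trans (Nat.le_succ _), ?_⟩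
        (.trans (h M _ _ (fun l => hM (some l)) ha hs) (ihb (ha.lt hs) rfl))
      have hx' : numeral (s x) ≠ [] := fun e => hx (numeral_eq_nil.1 e)
      obtain ⟨b, l, hbl⟩ := List.exists_cons_of_ne_nil hx'
      simp [Turing.TM2.step, hM none, hbl]

end Prog

/-! ### From while programs to PSPACE machines -/

namespace Prog

theorem Path.evals {N : ℕ} {Λ : Type} {M : Λ → MStmt N Λ} {B : ℕ} {c c' : MCfg N Λ}
    (h : Path M B c c') :
    ∃ n, (flip bind (Turing.TM2.step M))^[n] (some c) = some c' := by
  induction h using Relation.ReflTransGen.head_induction_on with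
  | refl => exact ⟨0, rfl⟩
  | head h _ ih =>
    obtain ⟨n, hn⟩ := ih
    refine ⟨n + 1, ?_⟩
    rw [iterate_succ_apply]
    simpa only [flip, Option.bind_eq_bind, Option.bind_some, h.2] using hn

/-- The machine is deterministic, so every configuration reachable from `c` lies on the given path
to the halting configuration. -/
theorem Path.small_of_reaches {N : ℕ} {Λ : Type} {M : Λ → MStmt N Λ} {B : ℕ} {c c' d : MCfg N Λ}
    (h : Path M B c c') (hc' : Small B c') (hs : Turing.TM2.step M c' = none)
    (hd : StateTransition.Reaches (Turing.TM2.step M) c d) : Small B d := by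
  induction h using Relation.ReflTransGen.head_induction_on with
  | refl =>
    obtain rfl | ⟨e, he, -⟩ := hd.cases_head
    · exact hc'
    · simp [hs] at he
  | head h _ ih =>
    obtain rfl | ⟨e, he, hed⟩ := hd.cases_head
    · exact h.1
    · rw [h.2, Option.mem_some_iff] at he
      subst he
      exact ih hed

/-- The left side is the form in which `Turing.initList` and `Turing.haltList` put a word on one
stack. Since stacks hold bijective numerals, it is the assignment with the value of the word in
variable `0`. -/
theorem stackOf_single {N : ℕ} (h : 0 < N) (l : List Bool) :
    (fun k : Fin (N + 1) => @dite (List Bool) (k = key h) (instDecidableEqFin _ k (key h))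
      (fun _ => l) fun _ => []) = stackOf N (update 0 0 (numeralVal l)) := by
  rw [stackOf_update h, numeral_numeralVal]
  funext k
  by_cases hk : k = key h
  · subst hk; simp
  · rw [dif_neg hk, update_of_ne hk]
    refine Fin.cases ?_ (fun i => ?_) k <;> rfl

open Classical in
/-- A language is in PSPACE if some while program decides it with values of polynomially many
bits. -/
theorem inPSPACE {L : Language Bool} (P : Prog) (c : ℕ)
    (h : ∀ (x : List Bool) (B : ℕ), (x.length + c) ^ c ≤ B →
      (∀ j, update (0 : ℕ → ℕ) 0 (numeralVal x) j < 2 ^ B) →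
      Exec B P (update 0 0 (numeralVal x))
        (update 0 0 (numeralVal [decide (x ∈ L)]))) : InPSPACE L := by
  obtain ⟨N, hN⟩ : ∃ N, P.Below N ∧ 0 < N := by
    obtain ⟨N, hN⟩ := P.exists_below
    exact ⟨N + 1, hN.mono (Nat.le_succ _), Nat.succ_pos _⟩
  obtain ⟨hP, hN⟩ := hN
  obtain ⟨Lab, _, entry, code, hcode⟩ := exists_code P hP
  let M : Option Lab → MStmt N (Option Lab) := fun l => match l with
    | none => .halt
    | some l => code some none l
  let tm : Turing.FinTM2 :=
    { K := Fin (N + 1), k₀ := key hN, k₁ := key hN, Γ := fun _ => Bool, Λ := Option Lab,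
      main := some entry, σ := Option Bool, initialState := none, m := M }
  -- The summand `n + 1` makes room for the input, whose value is below `2 ^ (n + 1)`.
  let bd : ℕ → ℕ := fun n => (n + c) ^ c + (n + 1)
  have hpath (x : List Bool) : Path M (bd x.length + 1)
      (Turing.initList tm x : MCfg N (Option Lab))
      (Turing.haltList tm [decide (x ∈ L)] : MCfg N (Option Lab)) ∧
      Small (bd x.length + 1) (Turing.haltList tm [decide (x ∈ L)] : MCfg N (Option Lab)) := by
    have hs (j : ℕ) : update (0 : ℕ → ℕ) 0 (numeralVal x) j < 2 ^ bd x.length := by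
      rw [update_apply]
      split_ifs
      · refine lt_of_lt_of_le ?_ (Nat.pow_le_pow_right (by norm_num)
          (show x.length + 1 ≤ bd x.length by simp only [bd]; omega))
        have := numeralVal_add_two_le x
        omega
      · simp
    have hx := h x (bd x.length) (by simp only [bd]; omega) hs
    have h1 := hcode M some none (fun _ => rfl) hx hs
    have hi : (Turing.initList tm x : MCfg N (Option Lab)) =
        ⟨some (some entry), none, stackOf N (update 0 0 (numeralVal x))⟩ := by
      rw [← stackOf_single hN]; rfl
    have hh : (Turing.haltList tm [decide (x ∈ L)] : MCfg N (Option Lab)) =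
        ⟨none, none, stackOf N (update 0 0 (numeralVal [decide (x ∈ L)]))⟩ := by
      rw [← stackOf_single hN]; rfl
    rw [hi, hh]
    have hsm (l : Option (Option Lab)) : Small (bd x.length + 1)
        (⟨l, none, stackOf N (update 0 0 (numeralVal [decide (x ∈ L)]))⟩ : MCfg N (Option Lab)) :=
      fun k => (length_stackOf_le (hx.lt hs) k).trans (Nat.le_succ _)
    exact ⟨h1.tail ⟨hsm _, rfl⟩, hsm _⟩
  let T : Turing.TM2Computable (id : List Bool → List Bool) Computability.encodeBool
      (fun x => decide (x ∈ L)) :=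
    { tm := tm
      inputAlphabet := Equiv.refl Bool
      outputAlphabet := Equiv.refl Bool
      outputsFun := fun x => by
        rw [id, show (Equiv.refl Bool).invFun = id from rfl, List.map_id, List.map_id]
        exact ⟨(hpath x).1.evals.choose, (hpath x).1.evals.choose_spec⟩ }
  refine ⟨T, Polynomial.C (N + 1) * ((Polynomial.X + Polynomial.C c) ^ c +
    (Polynomial.X + 1) + 1), fun _ => inferInstanceAs (Finite Bool), fun x d hd => ?_⟩
  have hd' : StateTransition.Reaches (Turing.TM2.step M)
      (Turing.initList tm x : MCfg N (Option Lab)) d := by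
    have : x.map T.inputAlphabet.invFun = x := List.map_id _
    rw [this] at hd
    exact hd
  have hsm := (hpath x).1.small_of_reaches (hpath x).2 rfl hd'
  have : T.tm.space d ≤ ∑ k : Fin (N + 1), (bd x.length + 1) :=
    Finset.sum_le_sum fun k _ => hsm k
  refine this.trans (le_of_eq ?_)
  simp [bd]

end Prog

/-! ### Basic while programs -/

namespace Prog

variable {B : ℕ} {s : ℕ → ℕ}

theorem Exec.of_eq {P : Prog} {s t t' : ℕ → ℕ} (h : Exec B P s t) (e : t = t') : Exec B P s t' :=
  e ▸ h

/-- A loop runs through a given sequence of assignments. -/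
theorem Exec.loop_seq {P : Prog} {x : ℕ} {s t : ℕ → ℕ} (σ : ℕ → ℕ → ℕ) (n : ℕ) (hs : s = σ 0)
    (ht : σ n = t) (h : ∀ i < n, σ i x ≠ 0 ∧ Exec B P (σ i) (σ (i + 1))) (hn : σ n x = 0) :
    Exec B (loop x P) s t := by
  subst hs ht
  induction n generalizing σ with
  | zero => exact .loop_done hn
  | succ n ih =>
    exact .loop_step (h 0 (Nat.succ_pos n)).1 (h 0 (Nat.succ_pos n)).2
      (ih (fun i => σ (i + 1)) (fun i hi => h (i + 1) (by omega)) hn)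

/-- `x := 0` -/
def clear (x : ℕ) : Prog :=
  loop x (dec x)

/-- `y := y + x; x := 0` -/
def move (x y : ℕ) : Prog :=
  loop x (seq (dec x) (inc y))

/-- `y := y + x`, where `z` is an auxiliary variable -/
def copy (x y z : ℕ) : Prog :=
  seq (loop x (seq (dec x) (seq (inc y) (inc z)))) (move z x)

theorem exec_clear (x : ℕ) : Exec B (clear x) s (update s x 0) := by
  refine .loop_seq (fun i => update s x (s x - i)) (s x) ?_ ?_ (fun i hi => ⟨?_, Exec.dec.of_eq ?_⟩) ?_
    <;> grind [update_apply]

theorem exec_move {x y : ℕ} (h : x ≠ y) (hB : s x + s y < 2 ^ B) :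
    Exec B (move x y) s (update (update s y (s y + s x)) x 0) := by
  refine .loop_seq (fun i => update (update s x (s x - i)) y (s y + i)) (s x) ?_ ?_
    (fun i hi => ⟨?_, .seq .dec ((Exec.inc ?_).of_eq ?_)⟩) ?_
    <;> grind [update_apply]

theorem exec_copy {x y z : ℕ} (h : x ≠ y) (h' : x ≠ z) (h'' : y ≠ z) (hz : s z = 0)
    (hB : s x + s y < 2 ^ B) : Exec B (copy x y z) s (update s y (s y + s x)) := by
  refine .seq (t := update (update (update s x 0) y (s y + s x)) z (s x)) ?_
    ((exec_move h'.symm ?_).of_eq ?_)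
  · refine .loop_seq (fun i => update (update (update s x (s x - i)) y (s y + i)) z i) (s x) ?_ ?_
      (fun i hi => ⟨?_, .seq .dec (.seq (.inc ?_) ((Exec.inc ?_).of_eq ?_))⟩) ?_
      <;> grind [update_apply]
  all_goals grind [update_apply]

/-! ### Programs for Cantor pairing -/

/-- The triangular numbers. -/
def tri : ℕ → ℕ
  | 0 => 0
  | n + 1 => tri n + (n + 1)

/-- The Cantor pairing function. -/
def cpair (x y : ℕ) : ℕ :=
  x + tri (x + y)

/-- The pair with a given Cantor number. -/
def walk : ℕ → ℕ × ℕ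
  | 0 => (0, 0)
  | n + 1 => if (walk n).2 = 0 then (0, (walk n).1 + 1) else ((walk n).1 + 1, (walk n).2 - 1)

/-- `walk` traverses the antidiagonals one after the other, in the order in which `cpair` numbers
them. A pair can thus be decoded by counting, with neither division nor roots. -/
theorem walk_cpair (x y : ℕ) : walk (cpair x y) = (x, y) := by
  generalize hn : cpair x y = n
  induction n generalizing x y with
  | zero =>
    rcases x with _ | x
    · rcases y with _ | y
      · rfl
      · simp [cpair, tri] at hn
    · simp [cpair] at hn
  | succ n ih =>
    rcases x with _ | x
    · rcases y with _ | y
      · simp [cpair, tri] at hn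
      · simp [walk, ih y 0 (by simp [cpair, tri] at hn ⊢; omega)]
    · simp [walk, ih x (y + 1) (by
        rw [cpair, show x + 1 + y = x + (y + 1) by ring] at hn; simp only [cpair]; omega)]

theorem tri_le (n : ℕ) : n ≤ tri n := by
  cases n <;> simp [tri]

theorem tri_le_sq (n : ℕ) : tri n ≤ n * n := by
  induction n with
  | zero => simp [tri]
  | succ n ih => simp only [tri]; nlinarith

theorem tri_mono {m n : ℕ} (h : m ≤ n) : tri m ≤ tri n := by
  induction n, h using Nat.le_induction with
  | base => rfl
  | succ n _ ih => exact ih.trans (Nat.le_add_right _ _)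

theorem add_le_cpair (x y : ℕ) : x + y ≤ cpair x y :=
  (tri_le _).trans (Nat.le_add_left _ _)

theorem walk_add_le (n : ℕ) : (walk n).1 + (walk n).2 ≤ n := by
  induction n with
  | zero => simp [walk]
  | succ n ih => simp only [walk]; split_ifs <;> simp <;> omega

/-- The code is below `(x + y + 1) ^ 2`. Pairing therefore costs only a constant factor in bits, and
polynomial size bounds survive it. -/
theorem size_cpair_le (x y : ℕ) : (cpair x y).size ≤ 2 * (x.size + y.size + 1) := by
  rw [Nat.size_le, mul_comm, pow_mul, pow_add, pow_add]
  have hx := Nat.lt_size_self x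
  have hy := Nat.lt_size_self y
  have h1 : x + y + 1 ≤ 2 ^ x.size * 2 ^ y.size * 2 ^ 1 := by nlinarith
  have h2 : cpair x y < (x + y + 1) ^ 2 := by
    have := tri_le_sq (x + y)
    simp only [cpair]
    nlinarith
  exact h2.trans_le (Nat.pow_le_pow_left h1 2)

/-- Replaces the variables `b` and `b + 1` by their pair, in variable `b`. -/
def pairProg (b : ℕ) : Prog :=
  seq (loop b (seq (dec b) (seq (inc (b + 1)) (inc (b + 2)))))
    (seq (loop (b + 1) (seq (dec (b + 1)) (seq (inc (b + 2)) (copy (b + 1) (b + 2) b))))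
      (move (b + 2) b))

/-- Replaces a pair in variable `b` by its components, in variables `b + 1` and `b + 2`. -/
def unpairProg (b : ℕ) : Prog :=
  loop b (seq (dec b) (ite (b + 2) (seq (dec (b + 2)) (inc (b + 1)))
    (seq (move (b + 1) (b + 2)) (inc (b + 2)))))

theorem exec_pairProg {b : ℕ} (h2 : s (b + 2) = 0)
    (hB : cpair (s b) (s (b + 1)) < 2 ^ B) :
    Exec B (pairProg b) s (update (update s b (cpair (s b) (s (b + 1)))) (b + 1) 0) := by
  have h0 := add_le_cpair (s b) (s (b + 1))
  refine .seq (t := update (update (update s b 0) (b + 1) (s b + s (b + 1))) (b + 2) (s b)) ?_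
    (.seq (t := update (update (update s b 0) (b + 1) 0) (b + 2) (cpair (s b) (s (b + 1)))) ?_
      ((exec_move ?_ ?_).of_eq ?_))
  · refine .loop_seq (fun i => update (update (update s b (s b - i)) (b + 1) (s (b + 1) + i))
      (b + 2) i) (s b) ?_ ?_ (fun i hi => ⟨?_, .seq .dec (.seq (.inc ?_) ((Exec.inc ?_).of_eq ?_))⟩) ?_
      <;> grind [update_apply]
  · obtain ⟨m, hm⟩ : ∃ m, m = s b + s (b + 1) := ⟨_, rfl⟩
    have hc : cpair (s b) (s (b + 1)) = s b + tri m := by rw [cpair, hm]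
    rw [← hm]
    -- The rounds add `m, m - 1, …, 1` in turn: one unit by the increment and the rest by `copy`,
    -- for which the emptied variable `b` is the auxiliary variable.
    refine .loop_seq (fun i => update (update (update s b 0) (b + 1) (m - i))
      (b + 2) (s b + (tri m - tri (m - i)))) m ?_ ?_
      (fun i hi => ?_) ?_
    · grind [update_apply]
    · rw [hc]; simp [tri]
    · obtain ⟨k, hk⟩ : ∃ k, m - i = k + 1 := ⟨m - i - 1, by omega⟩
      have h3 : tri (k + 1) ≤ tri m := tri_mono (by omega)
      have h4 : m - (i + 1) = k := by omega
      have h5 : tri (k + 1) = tri k + (k + 1) := rfl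
      simp only [hk, h4]
      refine ⟨by grind [update_apply], .seq .dec (.seq (.inc ?_) ((exec_copy ?_ ?_ ?_ ?_ ?_).of_eq ?_))⟩
        <;> grind [update_apply]
    · simp
  all_goals grind [update_apply]

theorem exec_unpairProg {b : ℕ} (h1 : s (b + 1) = 0) (h2 : s (b + 2) = 0) (hB : s b < 2 ^ B) :
    Exec B (unpairProg b) s
      (update (update (update s b 0) (b + 1) (walk (s b)).1) (b + 2) (walk (s b)).2) := by
  refine .loop_seq (fun i => update (update (update s b (s b - i)) (b + 1) (walk i).1)
    (b + 2) (walk i).2) (s b) ?_ ?_ (fun i hi => ⟨?_, .seq .dec ?_⟩) ?_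
  · grind [update_apply, walk]
  · grind [update_apply]
  · grind [update_apply]
  · have hw := walk_add_le i
    by_cases h : (walk i).2 = 0
    · refine .ite_neg ?_ (.seq (exec_move ?_ ?_) ((Exec.inc ?_).of_eq ?_))
        <;> grind [update_apply, walk]
    · refine .ite_pos ?_ (.seq .dec ((Exec.inc ?_).of_eq ?_)) <;> grind [update_apply, walk]
  · grind [update_apply]

end Prog

/-! ### Functions computable in polynomial space -/

/-- Types whose elements are coded by natural numbers. -/
class Coded (α : Type) where
  /-- the code of an element -/
  enc : α → ℕ

open Coded

instance : Coded ℕ := ⟨id⟩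

instance : Coded (List Bool) := ⟨numeralVal⟩

instance {α β : Type} [Coded α] [Coded β] : Coded (α × β) :=
  ⟨fun a => Prog.cpair (enc a.1) (enc a.2)⟩

variable {α β γ S : Type} [Coded α] [Coded β] [Coded γ] [Coded S]

/-- The binary size of the code of an element. -/
def codeSize (a : α) : ℕ :=
  Nat.size (enc a)

/-- `f` is bounded by a polynomial in the size of the argument. -/
def PolyBound (f : α → ℕ) : Prop :=
  ∃ c, ∀ a, f a ≤ (codeSize a + 2) ^ c

namespace PolyBound

theorem of_le {f g : α → ℕ} (hg : PolyBound g) (h : ∀ a, f a ≤ g a) : PolyBound f :=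
  hg.imp fun _ hc a => (h a).trans (hc a)

theorem codeSize : PolyBound (codeSize : α → ℕ) :=
  ⟨1, fun a => by simp⟩

theorem const (n : ℕ) : PolyBound (fun _ : α => n) :=
  ⟨n, fun a => (Nat.lt_two_pow_self).le.trans (Nat.pow_le_pow_left (by omega) n)⟩

theorem add {f g : α → ℕ} (hf : PolyBound f) (hg : PolyBound g) :
    PolyBound (fun a => f a + g a) := by
  obtain ⟨c, hc⟩ := hf
  obtain ⟨d, hd⟩ := hg
  refine ⟨c + d + 1, fun a => ?_⟩
  have h1 : 2 ≤ _root_.codeSize a + 2 := by omega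
  have h2 := (hc a).trans (Nat.pow_le_pow_right (by omega) (Nat.le_add_right c d))
  have h3 := (hd a).trans (Nat.pow_le_pow_right (by omega) (Nat.le_add_left d c))
  rw [pow_succ]
  nlinarith

theorem mul {f g : α → ℕ} (hf : PolyBound f) (hg : PolyBound g) :
    PolyBound (fun a => f a * g a) := by
  obtain ⟨c, hc⟩ := hf
  obtain ⟨d, hd⟩ := hg
  exact ⟨c + d, fun a => by rw [pow_add]; exact Nat.mul_le_mul (hc a) (hd a)⟩

theorem pow {f : α → ℕ} (hf : PolyBound f) (n : ℕ) : PolyBound (fun a => f a ^ n) := by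
  obtain ⟨c, hc⟩ := hf
  exact ⟨c * n, fun a => by rw [pow_mul]; exact Nat.pow_le_pow_left (hc a) n⟩

theorem comp {g : β → ℕ} (hg : PolyBound g) {f : α → β}
    (hf : PolyBound fun a => _root_.codeSize (f a)) : PolyBound fun a => g (f a) := by
  obtain ⟨c, hc⟩ := hg
  exact ((hf.add (const 2)).pow c).of_le fun a => hc (f a)

end PolyBound

/-- The program family computes `f` in the variable `b`, using the variables above `b` as auxiliary
variables that are initially and finally `0`, with values of at most `bd a` bits. -/
def Computes (P : ℕ → Prog) (bd : α → ℕ) (f : α → β) : Prop :=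
  ∀ (a : α) (b B : ℕ) (s : ℕ → ℕ), s b = enc a → (∀ j, b < j → s j = 0) → (∀ j, s j < 2 ^ B) →
    bd a ≤ B → (P b).Exec B s (update s b (enc (f a)))

/-- `f` is computable in polynomial space. -/
def PS (f : α → β) : Prop :=
  ∃ P bd, PolyBound bd ∧ Computes P bd f

open Classical in
/-- The predicate is decidable in polynomial space. -/
structure PSP (p : α → Prop) : Prop where
  ps : PS fun a => if p a then 1 else 0

theorem lt_of_codeSize_le {a : α} {B : ℕ} (h : codeSize a ≤ B) : enc a < 2 ^ B :=
  Nat.size_le.1 h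

theorem codeSize_pair (a : α) (b : β) : codeSize (a, b) ≤ 2 * (codeSize a + codeSize b + 1) :=
  Prog.size_cpair_le _ _

namespace PS

/-- The output is one of the values bounded during the execution, so a size bound on it comes for
free from the space bound. Composition depends on this. -/
theorem codeSize {f : α → β} (hf : PS f) : PolyBound fun a => codeSize (f a) := by
  obtain ⟨P, bd, hbd, h⟩ := hf
  refine (hbd.add .codeSize).of_le fun a => Nat.size_le.2 ?_
  have hs (j : ℕ) : update (0 : ℕ → ℕ) 0 (enc a) j < 2 ^ (bd a + _root_.codeSize a) := by
    have := lt_of_codeSize_le (a := a) (Nat.le_add_left (_root_.codeSize a) (bd a))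
    rw [update_apply]
    split_ifs
    exacts [this, by simp]
  simpa using (h a 0 _ (update 0 0 (enc a)) (by simp) (fun j hj => by simp [hj.ne']) hs
    (Nat.le_add_right _ _)).lt hs 0

theorem id : PS (fun a : α => a) :=
  -- Variable `b + 1` is zero, so this loop is never entered; it serves as the empty program.
  ⟨fun b => .loop (b + 1) (.dec (b + 1)), fun _ => 0, .const 0, fun a b B s hs h0 _ _ =>
    (Prog.Exec.loop_done (h0 _ (Nat.lt_succ_self b))).of_eq (by rw [← hs, update_eq_self])⟩

theorem comp {g : β → γ} {f : α → β} (hg : PS g) (hf : PS f) : PS fun a => g (f a) := by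
  have hsz := hf.codeSize
  obtain ⟨P, bd, hbd, h⟩ := hf
  obtain ⟨Q, bd', hbd', h'⟩ := hg
  refine ⟨fun b => .seq (P b) (Q b), _, hbd.add (hbd'.comp hsz), fun a b B s hs h0 hB hbd => ?_⟩
  have h1 := h a b B s hs h0 hB (by omega)
  refine .seq h1 ((h' (f a) b B _ (by simp) (fun j hj => ?_) (h1.lt hB) (by omega)).of_eq ?_)
  · rw [update_of_ne hj.ne', h0 j hj]
  · simp

/-- Programs see codes only. This moves computability between functions that agree on codes, and is
also used to rewrite values. -/
theorem of_enc {f g : α → β} (hf : PS f) (h : ∀ a, enc (f a) = enc (g a)) : PS g := by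
  obtain ⟨P, bd, hbd, hP⟩ := hf
  exact ⟨P, bd, hbd, fun a b B s hs h0 hB hbd => h a ▸ hP a b B s hs h0 hB hbd⟩

theorem pred : PS Nat.pred :=
  ⟨fun b => .dec b, fun _ => 0, .const 0, fun a b B s hs _ _ _ =>
    Prog.Exec.dec.of_eq (by rw [hs]; rfl)⟩

theorem succ : PS Nat.succ := by
  refine ⟨fun b => .inc b, _, (PolyBound.codeSize (α := ℕ)).add (.const 1),
    fun a b B s hs _ _ hB => (Prog.Exec.inc ?_).of_eq (by rw [hs]; rfl)⟩
  have h1 : s b < 2 ^ _root_.codeSize a := hs ▸ lt_of_codeSize_le le_rfl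
  have h2 : 2 ^ (_root_.codeSize a + 1) ≤ 2 ^ B := Nat.pow_le_pow_right (by norm_num) hB
  rw [pow_succ] at h2
  omega

theorem zero : PS (fun _ : α => 0) :=
  ⟨Prog.clear, fun _ => 0, .const 0, fun _ _ _ _ _ _ _ _ => Prog.exec_clear _⟩

theorem const (v : β) : PS (fun _ : α => v) := by
  have (n : ℕ) : PS (fun _ : α => n) := by
    induction n with
    | zero => exact zero
    | succ n ih => exact succ.comp ih
  obtain ⟨P, bd, hbd, hP⟩ := this (enc v)
  exact ⟨P, bd, hbd, hP⟩

theorem fst : PS (Prod.fst : α × β → α) := by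
  refine ⟨fun b => .seq (Prog.unpairProg b) (.seq (Prog.clear (b + 2)) (Prog.move (b + 1) b)),
    fun _ => 0, .const 0, fun a b B s hs h0 hB _ => ?_⟩
  have h1 := h0 (b + 1) (by omega)
  have h2 := h0 (b + 2) (by omega)
  have hw : Prog.walk (s b) = (enc a.1, enc a.2) := by rw [hs]; exact Prog.walk_cpair _ _
  have h3 := Prog.walk_add_le (s b)
  have h4 := hB b
  rw [hw] at h3
  refine .seq (Prog.exec_unpairProg h1 h2 (hB b)) (.seq (Prog.exec_clear _)
    ((Prog.exec_move ?_ ?_).of_eq ?_))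
  · omega
  · rw [hw]; grind [update_apply]
  · rw [hw]; grind [update_apply]

theorem snd : PS (Prod.snd : α × β → β) := by
  refine ⟨fun b => .seq (Prog.unpairProg b) (.seq (Prog.clear (b + 1)) (Prog.move (b + 2) b)),
    fun _ => 0, .const 0, fun a b B s hs h0 hB _ => ?_⟩
  have h1 := h0 (b + 1) (by omega)
  have h2 := h0 (b + 2) (by omega)
  have hw : Prog.walk (s b) = (enc a.1, enc a.2) := by rw [hs]; exact Prog.walk_cpair _ _
  have h3 := Prog.walk_add_le (s b)
  have h4 := hB b
  rw [hw] at h3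
  refine .seq (Prog.exec_unpairProg h1 h2 (hB b)) (.seq (Prog.exec_clear _)
    ((Prog.exec_move ?_ ?_).of_eq ?_))
  · omega
  · rw [hw]; grind [update_apply]
  · rw [hw]; grind [update_apply]

theorem pair {f : α → β} {g : α → γ} (hf : PS f) (hg : PS g) : PS fun a => (f a, g a) := by
  have hszf := hf.codeSize
  have hszg := hg.codeSize
  obtain ⟨P, bd, hbd, h⟩ := hf
  obtain ⟨Q, bd', hbd', h'⟩ := hg
  -- A subprogram needs every variable above its own to be zero. So each of `P`, `Q` runs in `b +
  -- 1`, with the value to be kept (first the argument, then `f a`) below it in `b`; the moves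
  -- through `b + 2` exchange the two.
  refine ⟨fun b => .seq (.copy b (b + 1) (b + 2)) (.seq (P (b + 1)) (.seq (.move b (b + 2))
    (.seq (.move (b + 1) b) (.seq (.move (b + 2) (b + 1)) (.seq (Q (b + 1)) (.pairProg b)))))),
    _, (hbd.add hbd').add (((hszf.add hszg).add (.const 1)).mul (.const 2)),
    fun a b B s hs h0 hB hbd => ?_⟩
  have h1 := h0 (b + 1) (by omega)
  have h2 := h0 (b + 2) (by omega)
  have hb := hB b
  have hfB : enc (f a) < 2 ^ B := lt_of_codeSize_le (by omega)
  have hgB : enc (g a) < 2 ^ B := lt_of_codeSize_le (by omega)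
  have hc : Prog.cpair (enc (f a)) (enc (g a)) < 2 ^ B :=
    lt_of_codeSize_le (a := (f a, g a)) ((codeSize_pair _ _).trans (by omega))
  refine .seq (t := update s (b + 1) (enc a))
    ((Prog.exec_copy ?_ ?_ ?_ ?_ ?_).of_eq ?_)
    (.seq (t := update s (b + 1) (enc (f a)))
      ((h a (b + 1) B _ ?_ ?_ ?_ ?_).of_eq ?_)
    (.seq (t := update (update (update s b 0) (b + 1) (enc (f a))) (b + 2) (enc a))
      ((Prog.exec_move ?_ ?_).of_eq ?_)
    (.seq (t := update (update s b (enc (f a))) (b + 2) (enc a))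
      ((Prog.exec_move ?_ ?_).of_eq ?_)
    (.seq (t := update (update s b (enc (f a))) (b + 1) (enc a))
      ((Prog.exec_move ?_ ?_).of_eq ?_)
    (.seq (t := update (update s b (enc (f a))) (b + 1) (enc (g a)))
      ((h' a (b + 1) B _ ?_ ?_ ?_ ?_).of_eq ?_)
    ((Prog.exec_pairProg ?_ ?_).of_eq ?_))))))
  all_goals try omega
  all_goals try grind [update_apply]
  funext j
  simp only [update_apply, enc]
  grind

theorem ite_ne_zero {c : α → ℕ} {f g : α → β} (hc : PS c) (hf : PS f) (hg : PS g) :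
    PS fun a => if c a ≠ 0 then f a else g a := by
  have hszc := hc.codeSize
  obtain ⟨P, bd, hbd, h⟩ := hf
  obtain ⟨Q, bd', hbd', h'⟩ := hg
  obtain ⟨R, bd'', hbd'', h''⟩ := hc
  -- The test runs on a copy of the argument. A nonzero result is cleared before `P` starts, since
  -- `P` expects zeros above `b`.
  refine ⟨fun b => .seq (.copy b (b + 1) (b + 2)) (.seq (R (b + 1))
    (.ite (b + 1) (.seq (.clear (b + 1)) (P b)) (Q b))),
    _, (hbd.add hbd').add (hbd''.add hszc), fun a b B s hs h0 hB hbd => ?_⟩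
  have h1 := h0 (b + 1) (by omega)
  have h2 := h0 (b + 2) (by omega)
  have hb := hB b
  have hcB : c a < 2 ^ B := lt_of_codeSize_le (a := c a) (by omega)
  have he : enc (c a) = c a := rfl
  refine .seq (t := update s (b + 1) (enc a))
    ((Prog.exec_copy ?_ ?_ ?_ ?_ ?_).of_eq ?_)
    (.seq (t := update s (b + 1) (c a)) ((h'' a (b + 1) B _ ?_ ?_ ?_ ?_).of_eq ?_) ?_)
  all_goals try omega
  all_goals try grind [update_apply]
  by_cases hca : c a = 0
  · refine .ite_neg (by simpa) ((h' a b B _ ?_ ?_ ?_ ?_).of_eq ?_)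
    all_goals try omega
    all_goals grind [update_apply]
  · refine .ite_pos (by simpa) (.seq (t := s) ((Prog.exec_clear _).of_eq ?_)
      ((h a b B _ ?_ ?_ ?_ ?_).of_eq ?_))
    all_goals try omega
    all_goals grind [update_apply]

/-- While loops: `n a` is the number of rounds. -/
theorem while_loop {g : α → S} {f : S → S} {c : S → ℕ} (hg : PS g) (hf : PS f) (hc : PS c)
    {n : α → ℕ} (hn : ∀ a, ∀ i < n a, c (f^[i] (g a)) ≠ 0) (hn' : ∀ a, c (f^[n a] (g a)) = 0)
    {bs : α → ℕ} (hbs : PolyBound bs) (h : ∀ a, ∀ i ≤ n a, _root_.codeSize (f^[i] (g a)) ≤ bs a) :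
    PS fun a => f^[n a] (g a) := by
  have hszc := hc.codeSize
  obtain ⟨P, bd, hbd, hP⟩ := hg
  obtain ⟨Q, bd', ⟨e, hbd'⟩, hQ⟩ := hf
  obtain ⟨R, bd'', ⟨e', hbd''⟩, hR⟩ := hc
  obtain ⟨e'', hszc⟩ := hszc
  have hpow (k : ℕ) : PolyBound fun a => (bs a + 2) ^ k := (hbs.add (.const 2)).pow k
  -- The space budget covers the start, the states, one round, one test and the test value. The
  -- number of rounds `n a` does not enter it, and `n` need not be computable.
  refine ⟨fun b => .seq (P b) (.seq (.seq (.copy b (b + 1) (b + 2)) (R (b + 1)))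
    (.loop (b + 1) (.seq (.clear (b + 1)) (.seq (Q b)
      (.seq (.copy b (b + 1) (b + 2)) (R (b + 1))))))),
    _, (hbd.add hbs).add ((hpow e).add ((hpow e').add (hpow e''))), fun a b B s hs h0 hB hB' => ?_⟩
  have hle {F : S → ℕ} {k : ℕ} (hF : ∀ x, F x ≤ (_root_.codeSize x + 2) ^ k) {i : ℕ} (hi : i ≤ n a) :
      F (f^[i] (g a)) ≤ (bs a + 2) ^ k :=
    (hF _).trans (Nat.pow_le_pow_left (Nat.add_le_add_right (h a i hi) 2) k)
  have h1 := h0 (b + 1) (by omega)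
  have h2 := h0 (b + 2) (by omega)
  have hxB {i : ℕ} (hi : i ≤ n a) : enc (f^[i] (g a)) < 2 ^ B :=
    lt_of_codeSize_le (by have := h a i hi; omega)
  have hcB {i : ℕ} (hi : i ≤ n a) : c (f^[i] (g a)) < 2 ^ B :=
    lt_of_codeSize_le (a := c (f^[i] (g a))) (by have := hle hszc hi; omega)
  have htest {i : ℕ} (hi : i ≤ n a) : Prog.Exec B (.seq (.copy b (b + 1) (b + 2)) (R (b + 1)))
      (update s b (enc (f^[i] (g a))))
      (update (update s b (enc (f^[i] (g a)))) (b + 1) (c (f^[i] (g a)))) := by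
    have := hxB hi
    have hbR := hle hbd'' hi
    refine .seq (t := update (update s b (enc (f^[i] (g a)))) (b + 1) (enc (f^[i] (g a))))
      ((Prog.exec_copy ?_ ?_ ?_ ?_ ?_).of_eq ?_) ((hR (f^[i] (g a)) (b + 1) B _ ?_ ?_ ?_ ?_).of_eq ?_)
    all_goals try omega
    all_goals try grind [update_apply]
    rw [update_idem]; rfl
  refine .seq (t := update s b (enc (f^[0] (g a)))) (hP a b B s hs h0 hB (by omega))
    (.seq (htest (Nat.zero_le _)) ?_)
  refine .loop_seq (fun i => update (update s b (enc (f^[i] (g a)))) (b + 1) (c (f^[i] (g a))))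
    (n a) rfl ?_ (fun i hi => ⟨?_, ?_⟩) ?_
  · have := hn' a
    grind [update_apply]
  · have := hn a i hi
    grind [update_apply]
  · have := hxB hi.le
    have hbQ := hle hbd' hi.le
    refine .seq (t := update s b (enc (f^[i] (g a)))) ((Prog.exec_clear _).of_eq ?_)
      (.seq (t := update s b (enc (f^[i + 1] (g a)))) ((hQ (f^[i] (g a)) b B _ ?_ ?_ ?_ ?_).of_eq ?_)
        (htest hi))
    all_goals try omega
    all_goals try grind [update_apply]
    rw [iterate_succ_apply', update_idem]
  · have := hn' a
    grind [update_apply]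

end PS

/-! ### Bounded recursion, arithmetic and bounded quantifiers -/

namespace PS

theorem fst' {f : α → β × γ} (hf : PS f) : PS fun a => (f a).1 :=
  fst.comp hf

theorem snd' {f : α → β × γ} (hf : PS f) : PS fun a => (f a).2 :=
  snd.comp hf

/-- Bounded primitive recursion. -/
theorem natRec {n : α → ℕ} {F : α → ℕ → β} {h : α × ℕ × β → β} (hn : PS n)
    (h0 : PS fun a => F a 0) (hh : PS h) (hF : ∀ a i, i < n a → F a (i + 1) = h (a, i, F a i))
    {bs : α → ℕ} (hbs : PolyBound bs) (hle : ∀ a, ∀ i ≤ n a, _root_.codeSize (F a i) ≤ bs a) :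
    PS fun a => F a (n a) := by
  -- The first component counts down and is the loop condition; the third counts up and is the index
  -- passed to `h`.
  let start : α → ℕ × α × ℕ × β := fun a => (n a, a, 0, F a 0)
  let step : ℕ × α × ℕ × β → ℕ × α × ℕ × β := fun x => (x.1.pred, x.2.1, x.2.2.1.succ, h x.2)
  have hs (a : α) (i : ℕ) (hi : i ≤ n a) : step^[i] (start a) = (n a - i, a, i, F a i) := by
    induction i with
    | zero => rfl
    | succ i ih =>
      rw [iterate_succ_apply', ih (by omega)]
      simp only [step, hF a i (by omega), Nat.pred_eq_sub_one, Nat.succ_eq_add_one]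
      congr 1
  have hstart : PS start := hn.pair (id.pair ((const 0).pair h0))
  have hstep : PS step :=
    (pred.comp fst).pair ((fst' snd).pair ((succ.comp (fst' (snd' snd))).pair (hh.comp snd)))
  have hszn := hn.codeSize
  have key : PS fun a => step^[n a] (start a) := by
    refine hstart.while_loop (c := Prod.fst) hstep fst (fun a i hi => ?_) (fun a => ?_)
      (((hszn.add ((PolyBound.codeSize.add ((hszn.add hbs).add (.const 1) |>.mul (.const 2))).add
        (.const 1) |>.mul (.const 2))).add (.const 1)).mul (.const 2)) (fun a i hi => ?_)
    · rw [hs a i hi.le]; simp; omega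
    · rw [hs a _ le_rfl]; simp
    · rw [hs a i hi]
      have h1 := codeSize_pair (n a - i) (a, i, F a i)
      have h2 := codeSize_pair a (i, F a i)
      have h3 := codeSize_pair i (F a i)
      have h4 := hle a i hi
      have h5 : _root_.codeSize (n a - i) ≤ _root_.codeSize (n a) :=
        Nat.size_le_size (Nat.sub_le _ _)
      have h6 : _root_.codeSize i ≤ _root_.codeSize (n a) := Nat.size_le_size hi
      omega
  refine (snd' (snd' (snd' key))).of_enc fun a => ?_
  rw [hs a _ le_rfl]

theorem succ' {f : α → ℕ} (hf : PS f) : PS fun a => f a + 1 :=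
  succ.comp hf

/-- Arithmetic by repeated unit steps, here and below: the number of rounds may be exponential in
the size of the arguments, but only the size of the intermediate values counts. -/
theorem add {f g : α → ℕ} (hf : PS f) (hg : PS g) : PS fun a => f a + g a := by
  refine natRec (F := fun a i => f a + i) (h := fun x => x.2.2 + 1) hg hf
    (succ' (snd' snd)) (fun _ _ _ => rfl) ((hf.codeSize.add hg.codeSize).add (.const 1))
    fun a i hi => ?_
  refine Nat.size_le.2 ?_
  have h1 : f a < 2 ^ _root_.codeSize (f a) := Nat.lt_size_self _
  have h2 : g a < 2 ^ _root_.codeSize (g a) := Nat.lt_size_self _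
  rw [pow_succ, pow_add]
  simp only [enc, id_eq]
  nlinarith

theorem sub {f g : α → ℕ} (hf : PS f) (hg : PS g) : PS fun a => f a - g a :=
  natRec (F := fun a i => f a - i) (h := fun x => x.2.2.pred) hg hf
    (pred.comp (snd' snd)) (fun _ _ _ => rfl) hf.codeSize
    fun _ _ _ => Nat.size_le_size (Nat.sub_le _ _)

theorem size_mul_le (m n : ℕ) : (m * n).size ≤ m.size + n.size := by
  rw [Nat.size_le, pow_add]
  exact Nat.mul_lt_mul'' (Nat.lt_size_self m) (Nat.lt_size_self n)

theorem mul {f g : α → ℕ} (hf : PS f) (hg : PS g) : PS fun a => f a * g a :=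
  natRec (F := fun a i => f a * i) (h := fun x => x.2.2 + f x.1) hg (const 0)
    ((snd' snd).add (hf.comp fst)) (fun _ _ _ => rfl) (hf.codeSize.add hg.codeSize)
    fun _ _ hi => (Nat.size_le_size (Nat.mul_le_mul_left _ hi)).trans (size_mul_le _ _)

theorem two_pow {f : α → ℕ} (hf : PS f) (hf' : PolyBound f) : PS fun a => 2 ^ f a :=
  natRec (F := fun _ i => 2 ^ i) (h := fun x => x.2.2 * 2) hf (const 1)
    ((snd' snd).mul (const 2)) (fun _ i _ => pow_succ 2 i) (hf'.add (.const 1))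
    fun a i hi => Nat.size_le.2 (Nat.pow_lt_pow_right (by norm_num) (by omega))

theorem ite {p : α → Prop} [DecidablePred p] {f g : α → β} (hp : PSP p) (hf : PS f) (hg : PS g) :
    PS fun a => if p a then f a else g a :=
  (ite_ne_zero hp.ps hf hg).of_enc fun a => by by_cases h : p a <;> simp [h]

end PS

namespace PSP

theorem comp {p : β → Prop} {f : α → β} (hp : PSP p) (hf : PS f) : PSP fun a => p (f a) :=
  ⟨PS.comp hp.ps hf⟩

theorem of_iff {p q : α → Prop} (hp : PSP p) (h : ∀ a, q a ↔ p a) : PSP q :=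
  (funext fun a => propext (h a) : q = p) ▸ hp

theorem of_ite {p : α → Prop} [DecidablePred p] (h : PS fun a => if p a then 1 else 0) : PSP p :=
  ⟨h.of_enc fun a => by by_cases h : p a <;> simp [h]⟩

open Classical in
theorem not {p : α → Prop} (hp : PSP p) : PSP fun a => ¬ p a :=
  of_ite <| (PS.ite hp (.const 0) (.const 1)).of_enc fun a => by by_cases h : p a <;> simp [h]

open Classical in
theorem and {p q : α → Prop} (hp : PSP p) (hq : PSP q) : PSP fun a => p a ∧ q a :=
  of_ite <| (PS.ite hp hq.ps (.const 0)).of_enc fun a => by by_cases h : p a <;> simp [h]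

open Classical in
theorem or {p q : α → Prop} (hp : PSP p) (hq : PSP q) : PSP fun a => p a ∨ q a :=
  of_ite <| (PS.ite hp (.const 1) hq.ps).of_enc fun a => by by_cases h : p a <;> simp [h]

theorem imp {p q : α → Prop} (hp : PSP p) (hq : PSP q) : PSP fun a => p a → q a :=
  (hp.not.or hq).of_iff fun _ => imp_iff_not_or

theorem iff {p q : α → Prop} (hp : PSP p) (hq : PSP q) : PSP fun a => p a ↔ q a :=
  ((hp.imp hq).and (hq.imp hp)).of_iff fun _ => iff_def

theorem le {f g : α → ℕ} (hf : PS f) (hg : PS g) : PSP fun a => f a ≤ g a :=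
  of_ite <| (PS.ite_ne_zero (hf.sub hg) (.const 0) (.const 1)).of_enc fun a => by
    by_cases h : f a ≤ g a
    · simp [h]
    · simp [h, Nat.sub_eq_zero_iff_le]

theorem lt {f g : α → ℕ} (hf : PS f) (hg : PS g) : PSP fun a => f a < g a :=
  (le hg hf).not.of_iff fun _ => not_le.symm

theorem eq {f g : α → ℕ} (hf : PS f) (hg : PS g) : PSP fun a => f a = g a :=
  ((le hf hg).and (le hg hf)).of_iff fun _ => le_antisymm_iff

theorem true : PSP fun _ : α => True :=
  of_ite <| by simpa using PS.const 1

open Classical in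
/-- Bounded existential quantification. -/
theorem exists_lt {n : α → ℕ} {p : α → ℕ → Prop} (hn : PS n) (hp : PSP fun x : α × ℕ => p x.1 x.2) :
    PSP fun a => ∃ i < n a, p a i := by
  refine of_ite <| PS.natRec (F := fun a k => if ∃ i < k, p a i then 1 else 0)
    (h := fun x => if x.2.2 ≠ 0 then 1 else if p x.1 x.2.1 then 1 else 0) hn ?_ ?_ ?_
    (.const 1) (fun a i _ => ?_)
  · simpa using PS.const 0
  · exact .ite_ne_zero (PS.snd' .snd) (.const 1) (hp.comp (PS.fst.pair (PS.fst' .snd))).ps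
  · intro a i _
    simp only [Order.lt_add_one_iff, le_iff_lt_or_eq, or_and_right, exists_or, exists_eq_left]
    by_cases h1 : ∃ j < i, p a j <;> by_cases h2 : p a i <;> simp [h1, h2]
  · refine Nat.size_le.2 ?_
    split_ifs <;> simp [enc]

theorem forall_lt {n : α → ℕ} {p : α → ℕ → Prop} (hn : PS n)
    (hp : PSP fun x : α × ℕ => p x.1 x.2) : PSP fun a => ∀ i < n a, p a i :=
  (exists_lt (p := fun a i => ¬ p a i) hn hp.not).not.of_iff fun a => by push Not; rfl

end PSP

/-! ### Functions computed from their graphs; division -/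

namespace PS

open Classical in
/-- A function with a bound is computable if its graph is decidable. -/
theorem of_graph {f b : α → ℕ} (hb : PS b) (hlt : ∀ a, f a < b a)
    (hp : PSP fun x : α × ℕ => f x.1 = x.2) : PS f := by
  have := natRec (F := fun a k => if f a < k then f a else 0)
    (h := fun x => if f x.1 = x.2.1 then x.2.1 else x.2.2) hb (by simpa using const 0)
    (.ite (hp.comp (fst.pair (fst' snd))) (fst' snd) (snd' snd)) ?_ hb.codeSize ?_
  · simpa [hlt] using this
  · intro a i _
    by_cases h1 : f a = i
    · simp [h1]
    · have : f a < i + 1 ↔ f a < i := by omega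
      simp [h1, this]
  · intro a i hi
    refine Nat.size_le_size ?_
    have := hlt a
    simp only [enc, id_eq]
    split_ifs <;> omega

/-- For a positive divisor the graph is `k * g ≤ f < (k + 1) * g`; the convention that division by
zero gives zero is a separate case. -/
theorem div {f g : α → ℕ} (hf : PS f) (hg : PS g) : PS fun a => f a / g a := by
  refine of_graph (succ' hf) (fun a => Nat.lt_succ_of_le (Nat.div_le_self _ _)) ?_
  have hf' : PS fun x : α × ℕ => f x.1 := hf.comp fst
  have hg' : PS fun x : α × ℕ => g x.1 := hg.comp fst
  refine PSP.of_iff (((PSP.eq hg' (const 0)).and (.eq snd (const 0))).or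
    ((PSP.lt (const 0) hg').and ((PSP.le (snd.mul hg') hf').and
      (PSP.lt hf' ((succ' snd).mul hg'))))) fun x => ?_
  rcases Nat.eq_zero_or_pos (g x.1) with h | h
  · simp [h, eq_comm]
  · rw [Nat.div_eq_iff h]
    simp only [h, h.ne', false_and, true_and, false_or, add_mul, one_mul]
    omega

theorem mod {f g : α → ℕ} (hf : PS f) (hg : PS g) : PS fun a => f a % g a :=
  (hf.sub (hg.mul (hf.div hg))).of_enc fun a => by
    rw [Nat.mod_eq_sub]

end PS

/-! ### Reachability in graphs of exponential size -/

/-- There is a walk of length `n`. -/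
def WalkLen (E : ℕ → ℕ → Prop) : ℕ → ℕ → ℕ → Prop
  | 0, u, v => u = v
  | n + 1, u, v => ∃ w, WalkLen E n u w ∧ E w v

theorem WalkLen.trans {E : ℕ → ℕ → Prop} {m n u v w : ℕ} (h₁ : WalkLen E m u v)
    (h₂ : WalkLen E n v w) : WalkLen E (m + n) u w := by
  induction n generalizing w with
  | zero => exact h₂ ▸ h₁
  | succ n ih =>
    obtain ⟨x, hx, hxw⟩ := h₂
    exact ⟨x, ih hx, hxw⟩

theorem walkLen_add {E : ℕ → ℕ → Prop} {m n u w : ℕ} (h : WalkLen E (m + n) u w) :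
    ∃ v, WalkLen E m u v ∧ WalkLen E n v w := by
  induction n generalizing w with
  | zero => exact ⟨w, h, rfl⟩
  | succ n ih =>
    obtain ⟨x, hx, hxw⟩ := h
    obtain ⟨v, hv, hvx⟩ := ih hx
    exact ⟨v, hv, x, hvx, hxw⟩

theorem exists_walkLen {E : ℕ → ℕ → Prop} {u v : ℕ} (h : Relation.ReflTransGen E u v) :
    ∃ n, WalkLen E n u v := by
  induction h with
  | refl => exact ⟨0, rfl⟩
  | tail _ h ih => exact ih.imp' Nat.succ fun n hn => ⟨_, hn, h⟩

theorem WalkLen.lt {E : ℕ → ℕ → Prop} {N : ℕ} (hE : ∀ u v, E u v → v < N) {n u v : ℕ}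
    (hu : u < N) (h : WalkLen E n u v) : v < N := by
  cases n with
  | zero => exact h ▸ hu
  | succ n => exact hE _ _ h.choose_spec.2

/-- A shortest walk has less than `N` steps. -/
theorem exists_walkLen_lt {E : ℕ → ℕ → Prop} {N : ℕ} (hE : ∀ u v, E u v → v < N) {u v : ℕ}
    (hu : u < N) (h : Relation.ReflTransGen E u v) : ∃ n < N, WalkLen E n u v := by
  classical
  have hex := exists_walkLen h
  refine ⟨Nat.find hex, ?_, Nat.find_spec hex⟩
  by_contra! hN
  generalize hd : Nat.find hex = d at hN
  have hspec := hd ▸ Nat.find_spec hex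
  have hsplit (i : ℕ) : ∃ w, i ≤ d → WalkLen E i u w ∧ WalkLen E (d - i) w v := by
    by_cases hi : i ≤ d
    · obtain ⟨w, hw⟩ := walkLen_add (m := i) (n := d - i) (by rwa [Nat.add_sub_cancel' hi])
      exact ⟨w, fun _ => hw⟩
    · exact ⟨0, fun h => absurd h hi⟩
  choose f hf using hsplit
  -- The `d + 1 > N` positions of a shortest walk repeat a vertex, and cutting out the part between
  -- the two visits gives a shorter walk.
  obtain ⟨i, hi, j, hj, hij, he⟩ := Finset.exists_ne_map_eq_of_card_lt_of_maps_to
    (s := Finset.range (d + 1)) (t := Finset.range N) (by simp; omega) (f := f)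
    (fun i hi => by
      have := (hf i (by simpa [Nat.lt_succ_iff] using hi)).1.lt hE hu
      simpa using this)
  simp only [Finset.mem_range, Nat.lt_succ_iff] at hi hj
  wlog hlt : i < j generalizing i j
  · exact this j i hij.symm he.symm hj hi (by omega)
  have := Nat.find_min' hex ((hf i hi).1.trans (he ▸ (hf j hj).2))
  omega

/-! ### Savitch's recursion and its evaluation with an explicit stack -/

/-- Savitch's recursion: there is a walk of length at most `2 ^ k` through vertices below `N`. -/
def Savitch (N : ℕ) (E : ℕ → ℕ → Prop) : ℕ → ℕ → ℕ → Prop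
  | 0, u, v => u = v ∨ E u v
  | k + 1, u, v => ∃ w < N, Savitch N E k u w ∧ Savitch N E k w v

theorem Savitch.reflTransGen {N : ℕ} {E : ℕ → ℕ → Prop} {k u v : ℕ} (h : Savitch N E k u v) :
    Relation.ReflTransGen E u v := by
  induction k generalizing u v with
  | zero =>
    rcases h with rfl | h
    exacts [.refl, .single h]
  | succ k ih =>
    obtain ⟨w, -, h₁, h₂⟩ := h
    exact (ih h₁).trans (ih h₂)

theorem WalkLen.savitch {N : ℕ} {E : ℕ → ℕ → Prop} (hE : ∀ u v, E u v → v < N) {k n u v : ℕ}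
    (hu : u < N) (hn : n ≤ 2 ^ k) (h : WalkLen E n u v) : Savitch N E k u v := by
  induction k generalizing n u v with
  | zero =>
    rw [pow_zero, Nat.le_one_iff_eq_zero_or_eq_one] at hn
    rcases hn with rfl | rfl
    · exact .inl h
    · obtain ⟨w, rfl, hw⟩ := h
      exact .inr hw
  | succ k ih =>
    rw [pow_succ] at hn
    obtain ⟨w, h₁, h₂⟩ := walkLen_add (m := n / 2) (n := n - n / 2)
      (by rwa [Nat.add_sub_cancel' (Nat.div_le_self _ _)])
    have hw := h₁.lt hE hu
    exact ⟨w, hw, ih hu (by omega) h₁, ih hw (by omega) h₂⟩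

theorem savitch_iff {N : ℕ} {E : ℕ → ℕ → Prop} (hE : ∀ u v, E u v → v < N) {k u v : ℕ}
    (hu : u < N) (hk : N ≤ 2 ^ k) : Savitch N E k u v ↔ Relation.ReflTransGen E u v := by
  refine ⟨Savitch.reflTransGen, fun h => ?_⟩
  obtain ⟨n, hn, hw⟩ := exists_walkLen_lt hE hu h
  exact hw.savitch hE hu (by omega)

open Classical in
/-- One step of the evaluation of Savitch's recursion. A state `(m, k, u, v, T)` consists of the
mode `m` (`2`: call, `1`: return true, `0`: return false), the level `k`, the current goal `u, v` and
the stack `T`. A stack entry holds a bit that tells which half of the walk the current goal is, and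
the other end of the whole walk. -/
noncomputable def savitchStep (N : ℕ) (E : ℕ → ℕ → Prop) (x : ℕ × ℕ × ℕ × ℕ × ℕ) :
    ℕ × ℕ × ℕ × ℕ × ℕ :=
  if x.1 = 2 then
    if x.2.1 = 0 then
      (if x.2.2.1 = x.2.2.2.1 ∨ E x.2.2.1 x.2.2.2.1 then 1 else 0, 0, x.2.2.1, x.2.2.2.1, x.2.2.2.2)
    else (2, x.2.1 - 1, x.2.2.1, 0, (x.2.2.2.2 * N + x.2.2.2.1) * 2)
  else if x.1 = 1 then
    if x.2.2.2.2 % 2 = 0 then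
      (2, x.2.1, x.2.2.2.1, x.2.2.2.2 / 2 % N, (x.2.2.2.2 / 2 / N * N + x.2.2.1) * 2 + 1)
    else (1, x.2.1 + 1, x.2.2.2.2 / 2 % N, x.2.2.2.1, x.2.2.2.2 / 2 / N)
  else
    if x.2.2.2.2 % 2 = 0 then
      if x.2.2.2.1 + 1 < N then (2, x.2.1, x.2.2.1, x.2.2.2.1 + 1, x.2.2.2.2)
      else (0, x.2.1 + 1, x.2.2.1, x.2.2.2.2 / 2 % N, x.2.2.2.2 / 2 / N)
    else
      if x.2.2.1 + 1 < N then
        (2, x.2.1, x.2.2.2.2 / 2 % N, x.2.2.1 + 1, (x.2.2.2.2 / 2 / N * N + x.2.2.2.1) * 2)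
      else (0, x.2.1 + 1, x.2.2.2.2 / 2 % N, x.2.2.2.1, x.2.2.2.2 / 2 / N)

/-- The evaluation leads from `x` to `y`, not leaving level `k` before. -/
def SavitchRun (N : ℕ) (E : ℕ → ℕ → Prop) (k : ℕ) :
    ℕ × ℕ × ℕ × ℕ × ℕ → ℕ × ℕ × ℕ × ℕ × ℕ → Prop :=
  Relation.ReflTransGen fun x y => (x.1 = 2 ∨ x.2.1 < k) ∧ savitchStep N E x = y

theorem SavitchRun.mono {N : ℕ} {E : ℕ → ℕ → Prop} {k l : ℕ} (hkl : k ≤ l)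
    {x y : ℕ × ℕ × ℕ × ℕ × ℕ} (h : SavitchRun N E k x y) : SavitchRun N E l x y :=
  Relation.ReflTransGen.mono (fun _ _ h => ⟨h.1.imp_right fun h => h.trans_le hkl, h.2⟩) _ _ h

theorem SavitchRun.trans {N : ℕ} {E : ℕ → ℕ → Prop} {k : ℕ} {x y z : ℕ × ℕ × ℕ × ℕ × ℕ}
    (h₁ : SavitchRun N E k x y) (h₂ : SavitchRun N E k y z) : SavitchRun N E k x z :=
  Relation.ReflTransGen.trans h₁ h₂

theorem SavitchRun.head {N : ℕ} {E : ℕ → ℕ → Prop} {k : ℕ} {x y : ℕ × ℕ × ℕ × ℕ × ℕ}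
    (hx : x.1 = 2 ∨ x.2.1 < k) (h : SavitchRun N E k (savitchStep N E x) y) :
    SavitchRun N E k x y :=
  Relation.ReflTransGen.head ⟨hx, rfl⟩ h

theorem SavitchRun.single {N : ℕ} {E : ℕ → ℕ → Prop} {k : ℕ} {x y : ℕ × ℕ × ℕ × ℕ × ℕ}
    (hx : x.1 = 2 ∨ x.2.1 < k) (h : savitchStep N E x = y) : SavitchRun N E k x y :=
  Relation.ReflTransGen.single ⟨hx, h⟩

-- Evaluating a goal puts the answer into the mode and restores the level, the goal and the stack,
-- whatever the stack `T` is. This is what lets the evaluations of both halves be inserted into the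
-- evaluation one level up.
open Classical in
theorem savitchRun (N : ℕ) (E : ℕ → ℕ → Prop) (k u v T : ℕ) (hu : u < N) (hv : v < N) :
    SavitchRun N E k (2, k, u, v, T) (if Savitch N E k u v then 1 else 0, k, u, v, T) := by
  induction k generalizing u v T with
  | zero => exact .single (.inl rfl) (by
    by_cases h : u = v ∨ E u v <;> simp [savitchStep, Savitch, h])
  | succ k ih =>
    have hdiv : (T * N + v) / N = T := by
      rw [mul_comm, Nat.mul_add_div (by omega), Nat.div_eq_of_lt hv, add_zero]
    have hdiv' : (T * N + u) / N = T := by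
      rw [mul_comm, Nat.mul_add_div (by omega), Nat.div_eq_of_lt hu, add_zero]
    have hmod : (T * N + v) % N = v := by simp [Nat.mod_eq_of_lt hv]
    have hmod' : (T * N + u) % N = u := by simp [Nat.mod_eq_of_lt hu]
    have half (x : ℕ) : (x * 2 + 1) / 2 = x := by omega
    -- The search over midpoints, resumed at `w`: `d` further candidates remain after `w`, and the
    -- induction is on `d`.
    have key (d w : ℕ) (hd : w + d + 1 = N) : SavitchRun N E (k + 1)
        (2, k, u, w, (T * N + v) * 2)
        (if ∃ w', w ≤ w' ∧ w' < N ∧ Savitch N E k u w' ∧ Savitch N E k w' v then 1 else 0,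
          k + 1, u, v, T) := by
      induction d generalizing w with
      | zero =>
        have hiff : (∃ w', w ≤ w' ∧ w' < N ∧ Savitch N E k u w' ∧ Savitch N E k w' v) ↔
            Savitch N E k u w ∧ Savitch N E k w v := by
          constructor
          · rintro ⟨w', h1, h2, h3⟩
            obtain rfl : w' = w := by omega
            exact h3
          · exact fun h => ⟨w, le_rfl, by omega, h⟩
        simp only [hiff]
        refine .trans ((ih u w _ hu (by omega)).mono (Nat.le_succ k)) ?_
        by_cases h1 : Savitch N E k u w
        · refine .head (.inr (Nat.lt_succ_self k)) ?_
          simp only [savitchStep, h1, if_true]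
          simp only [OfNat.one_ne_ofNat, if_false, Nat.mul_mod_left, if_true,
            Nat.mul_div_cancel _ (show 0 < 2 by norm_num), hdiv, hmod]
          refine .trans ((ih w v _ (by omega) hv).mono (Nat.le_succ k)) ?_
          refine .single (.inr (Nat.lt_succ_self k)) ?_
          by_cases h2 : Savitch N E k w v
          · simp [savitchStep, h2, half, hdiv', hmod', Nat.add_mod]
          · simp [savitchStep, h2, half, hdiv', hmod', Nat.add_mod, show ¬ w + 1 < N by omega]
        · refine .single (.inr (Nat.lt_succ_self k)) ?_
          simp [savitchStep, h1, hdiv, hmod, show ¬ w + 1 < N by omega]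
      | succ d ihd =>
        have hiff : (∃ w', w ≤ w' ∧ w' < N ∧ Savitch N E k u w' ∧ Savitch N E k w' v) ↔
            (Savitch N E k u w ∧ Savitch N E k w v) ∨
            ∃ w', w + 1 ≤ w' ∧ w' < N ∧ Savitch N E k u w' ∧ Savitch N E k w' v := by
          constructor
          · rintro ⟨w', h1, h2, h3⟩
            rcases h1.eq_or_lt with rfl | h1
            exacts [.inl h3, .inr ⟨w', h1, h2, h3⟩]
          · rintro (h | ⟨w', h1, h2⟩)
            exacts [⟨w, le_rfl, by omega, h⟩, ⟨w', by omega, h2⟩]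
        have hnext := ihd (w + 1) (by omega)
        simp only [hiff]
        refine .trans ((ih u w _ hu (by omega)).mono (Nat.le_succ k)) ?_
        by_cases h1 : Savitch N E k u w
        · refine .head (.inr (Nat.lt_succ_self k)) ?_
          simp only [savitchStep, h1, if_true]
          simp only [OfNat.one_ne_ofNat, if_false, Nat.mul_mod_left, if_true,
            Nat.mul_div_cancel _ (show 0 < 2 by norm_num), hdiv, hmod]
          refine .trans ((ih w v _ (by omega) hv).mono (Nat.le_succ k)) ?_
          by_cases h2 : Savitch N E k w v
          · refine .single (.inr (Nat.lt_succ_self k)) ?_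
            simp [savitchStep, h2, half, hdiv', hmod', Nat.add_mod]
          · refine .head (.inr (Nat.lt_succ_self k)) ?_
            simpa [savitchStep, h2, half, hdiv', hmod', Nat.add_mod,
              show w + 1 < N by omega] using hnext
        · refine .head (.inr (Nat.lt_succ_self k)) ?_
          simpa [savitchStep, h1, show w + 1 < N by omega] using hnext
    refine .head (.inl rfl) ?_
    have h0 := key (N - 1) 0 (by omega)
    have hiff : (∃ w', 0 ≤ w' ∧ w' < N ∧ Savitch N E k u w' ∧ Savitch N E k w' v) ↔
        Savitch N E (k + 1) u v := by simp [Savitch]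
    by_cases h : Savitch N E (k + 1) u v
    · rw [if_pos (hiff.2 h)] at h0
      simpa [savitchStep, h] using h0
    · rw [if_neg (fun e => h (hiff.1 e))] at h0
      simpa [savitchStep, h] using h0

/-- The invariant that bounds the states of the evaluation. -/
def SavitchInv (N K : ℕ) (x : ℕ × ℕ × ℕ × ℕ × ℕ) : Prop :=
  x.1 ≤ 2 ∧ x.2.1 ≤ K ∧ x.2.2.1 < N ∧ x.2.2.2.1 < N ∧ x.2.2.2.2 < (2 * N) ^ (K - x.2.1)

/-- A stack entry, a bit and a vertex, is one digit in base `2 * N`. Going down a level pushes a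
digit and going up pops one, so at level `k` the stack has at most `K - k` digits. -/
theorem SavitchInv.step {N K : ℕ} {E : ℕ → ℕ → Prop} {x : ℕ × ℕ × ℕ × ℕ × ℕ}
    (h : SavitchInv N K x) (hx : x.1 = 2 ∨ x.2.1 < K) : SavitchInv N K (savitchStep N E x) := by
  obtain ⟨m, k, u, v, T⟩ := x
  obtain ⟨hm, hk, hu, hv, hT⟩ := h
  simp only at hm hk hu hv hT hx
  have hN : 0 < N := by omega
  have push {M t d : ℕ} (ht : t < M) (hd : d < N) : (t * N + d) * 2 + 1 < M * (2 * N) := by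
    have : (t + 1) * N ≤ M * N := Nat.mul_le_mul_right _ ht
    nlinarith
  have pop {M : ℕ} (h : T < M * (2 * N)) : T / 2 / N < M := by
    rw [Nat.div_div_eq_div_mul]
    exact Nat.div_lt_of_lt_mul (by rwa [mul_comm])
  have hmod : T / 2 % N < N := Nat.mod_lt _ hN
  by_cases hm2 : m = 2
  · by_cases hk0 : k = 0
    · simp only [savitchStep, hm2, hk0, if_true]
      subst hk0
      refine ⟨?_, Nat.zero_le _, hu, hv, hT⟩
      simp only
      split_ifs <;> omega
    · simp only [savitchStep, hm2, hk0, if_true, if_false]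
      refine ⟨le_rfl, by simp only; omega, hu, hN, ?_⟩
      simp only
      rw [show K - (k - 1) = K - k + 1 by omega, pow_succ]
      exact (Nat.lt_succ_self _).trans (push hT hv)
  · have hkK : k < K := by omega
    obtain ⟨M, hM⟩ : ∃ M, M = (2 * N) ^ (K - (k + 1)) := ⟨_, rfl⟩
    have hMk : (2 * N) ^ (K - k) = M * (2 * N) := by
      rw [hM, ← pow_succ]; congr 1; omega
    rw [hMk] at hT
    have hp := pop hT
    simp only [savitchStep, hm2, if_false]
    split_ifs
    all_goals refine ⟨by simp, by simp only; omega, by first | exact hu | exact hv | exact hmod,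
      by first | exact hu | exact hv | exact hmod | assumption, ?_⟩
    all_goals simp only [hMk, ← hM]
    · exact push hp hu
    · exact hp
    · exact hT
    · exact hp
    · exact (Nat.lt_succ_self _).trans (push hp hv)
    · exact hp

theorem SavitchRun.exists_iterate {N : ℕ} {E : ℕ → ℕ → Prop} {k : ℕ} {x y : ℕ × ℕ × ℕ × ℕ × ℕ}
    (h : SavitchRun N E k x y) : ∃ n, (savitchStep N E)^[n] x = y ∧
      ∀ i < n, ((savitchStep N E)^[i] x).1 = 2 ∨ ((savitchStep N E)^[i] x).2.1 < k := by
  induction h using Relation.ReflTransGen.head_induction_on with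
  | refl => exact ⟨0, rfl, by simp⟩
  | head h _ ih =>
    obtain ⟨n, hn, hi⟩ := ih
    obtain ⟨h1, rfl⟩ := h
    refine ⟨n + 1, hn, fun i hin => ?_⟩
    rcases i with _ | i
    exacts [h1, hi i (by omega)]

open Classical in
theorem ps_savitchStep {N : α → ℕ} {E : α → ℕ → ℕ → Prop} (hN : PS N)
    (hE : PSP fun x : α × ℕ × ℕ => E x.1 x.2.1 x.2.2) :
    PS fun x : α × ℕ × ℕ × ℕ × ℕ × ℕ => savitchStep (N x.1) (E x.1) x.2 := by
  have hN' : PS fun x : α × ℕ × ℕ × ℕ × ℕ × ℕ => N x.1 := hN.comp .fst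
  have hE' : PSP fun x : α × ℕ × ℕ × ℕ × ℕ × ℕ => E x.1 x.2.2.2.1 x.2.2.2.2.1 :=
    hE.comp (PS.fst.pair ((PS.fst' (.snd' (.snd' .snd))).pair (.fst' (.snd' (.snd' (.snd' .snd))))))
  have h1 : PS fun x : α × ℕ × ℕ × ℕ × ℕ × ℕ => x.2.1 := .fst' .snd
  have h2 : PS fun x : α × ℕ × ℕ × ℕ × ℕ × ℕ => x.2.2.1 := .fst' (.snd' .snd)
  have h3 : PS fun x : α × ℕ × ℕ × ℕ × ℕ × ℕ => x.2.2.2.1 := .fst' (.snd' (.snd' .snd))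
  have h4 : PS fun x : α × ℕ × ℕ × ℕ × ℕ × ℕ => x.2.2.2.2.1 := .fst' (.snd' (.snd' (.snd' .snd)))
  have h5 : PS fun x : α × ℕ × ℕ × ℕ × ℕ × ℕ => x.2.2.2.2.2 := .snd' (.snd' (.snd' (.snd' .snd)))
  unfold savitchStep
  clear hN hE
  repeat' with_reducible first
    | assumption | exact .const _ | refine .ite ?_ ?_ ?_ | refine .pair ?_ ?_ | refine .eq ?_ ?_
    | refine .lt ?_ ?_ | refine .or ?_ ?_ | refine .add ?_ ?_ | refine .sub ?_ ?_
    | refine .mul ?_ ?_ | refine .div ?_ ?_ | refine .mod ?_ ?_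

theorem SavitchInv.iterate {N K : ℕ} {E : ℕ → ℕ → Prop} {x : ℕ × ℕ × ℕ × ℕ × ℕ}
    (h : SavitchInv N K x) {n : ℕ} (hn : ∀ i < n, ((savitchStep N E)^[i] x).1 = 2 ∨
      ((savitchStep N E)^[i] x).2.1 < K) : SavitchInv N K ((savitchStep N E)^[n] x) := by
  induction n with
  | zero => exact h
  | succ n ih =>
    rw [iterate_succ_apply']
    exact (ih fun i hi => hn i (by omega)).step (hn n (Nat.lt_succ_self n))

theorem SavitchInv.codeSize_le {N K : ℕ} {x : ℕ × ℕ × ℕ × ℕ × ℕ} (h : SavitchInv N K x) :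
    codeSize x ≤ 100 * (K + codeSize N + (codeSize N + 1) * K + 1) := by
  obtain ⟨m, k, u, v, T⟩ := x
  obtain ⟨hm, hk, hu, hv, hT⟩ := h
  simp only at hm hk hu hv hT
  -- Each of the four nested pairings roughly doubles the size; the factor 100 is a generous total.
  have h1 := codeSize_pair m (k, u, v, T)
  have h2 := codeSize_pair k (u, v, T)
  have h3 := codeSize_pair u (v, T)
  have h4 := codeSize_pair v T
  have hm' : codeSize m ≤ 2 := Nat.size_le.2 (show m < 4 by omega)
  have hk' : codeSize k ≤ K := Nat.size_le.2 (hk.trans_lt Nat.lt_two_pow_self)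
  have hu' : codeSize u ≤ codeSize N := Nat.size_le_size hu.le
  have hv' : codeSize v ≤ codeSize N := Nat.size_le_size hv.le
  have hT' : codeSize T ≤ (codeSize N + 1) * K := by
    refine Nat.size_le.2 (hT.trans_le ?_)
    rw [pow_mul]
    refine (Nat.pow_le_pow_right (by omega) (Nat.sub_le _ _)).trans (Nat.pow_le_pow_left ?_ _)
    rw [pow_succ, mul_comm]
    exact Nat.mul_le_mul_right _ (Nat.lt_size_self N).le
  omega

open Classical in
/-- Reachability in a graph with exponentially many vertices is decidable in polynomial space. -/
theorem PSP.reflTransGen {N K : α → ℕ} {E : α → ℕ → ℕ → Prop} (hN : PS N) (hK : PS K)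
    (hK' : PolyBound K) (hNK : ∀ a, N a ≤ 2 ^ K a) (hN0 : ∀ a, 0 < N a)
    (hE : PSP fun x : α × ℕ × ℕ => E x.1 x.2.1 x.2.2) (hEN : ∀ a u v, E a u v → v < N a) :
    PSP fun x : α × ℕ × ℕ => x.2.1 < N x.1 ∧ x.2.2 < N x.1 ∧
      Relation.ReflTransGen (E x.1) x.2.1 x.2.2 := by
  let ok : α × ℕ × ℕ → Prop := fun x => x.2.1 < N x.1 ∧ x.2.2 < N x.1
  -- Goals outside the graph start in mode `0` at level `K`, where the loop stops at once with
  -- answer false.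
  let start : α × ℕ × ℕ → α × ℕ × ℕ × ℕ × ℕ × ℕ := fun x =>
    (x.1, if ok x then (2, K x.1, x.2.1, x.2.2, 0) else (0, K x.1, 0, 0, 0))
  let step : α × ℕ × ℕ × ℕ × ℕ × ℕ → α × ℕ × ℕ × ℕ × ℕ × ℕ := fun y =>
    (y.1, savitchStep (N y.1) (E y.1) y.2)
  let cont : α × ℕ × ℕ × ℕ × ℕ × ℕ → ℕ := fun y =>
    if y.2.1 = 2 ∨ y.2.2.1 < K y.1 then 1 else 0
  have hstart : PS start := by
    have hN' : PS fun x : α × ℕ × ℕ => N x.1 := hN.comp .fst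
    have hK' : PS fun x : α × ℕ × ℕ => K x.1 := hK.comp .fst
    have h1 : PS fun x : α × ℕ × ℕ => x.2.1 := .fst' .snd
    have h2 : PS fun x : α × ℕ × ℕ => x.2.2 := .snd' .snd
    exact .pair .fst (.ite ((PSP.lt h1 hN').and (.lt h2 hN'))
      (.pair (.const 2) (.pair hK' (.pair h1 (.pair h2 (.const 0)))))
      (.pair (.const 0) (.pair hK' (.const (0, 0, 0)))))
  have hstep : PS step := PS.fst.pair (ps_savitchStep hN hE)
  have hcont : PS cont := .ite ((PSP.eq (.fst' .snd) (.const 2)).or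
    (.lt (.fst' (.snd' .snd)) (hK.comp .fst))) (.const 1) (.const 0)
  have hiter (a : α) (s : ℕ × ℕ × ℕ × ℕ × ℕ) (i : ℕ) :
      step^[i] (a, s) = (a, (savitchStep (N a) (E a))^[i] s) := by
    induction i with
    | zero => rfl
    | succ i ih => rw [iterate_succ_apply', iterate_succ_apply', ih]
  have hrun (x : α × ℕ × ℕ) : ∃ n, (∀ i < n, cont (step^[i] (start x)) ≠ 0) ∧
      cont (step^[n] (start x)) = 0 ∧
      (step^[n] (start x)).2.1 =
        (if x.2.1 < N x.1 ∧ x.2.2 < N x.1 ∧ Relation.ReflTransGen (E x.1) x.2.1 x.2.2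
          then 1 else 0) ∧
      ∀ i ≤ n, SavitchInv (N x.1) (K x.1) (step^[i] (start x)).2 := by
    by_cases hx : ok x
    · have hs : start x = (x.1, 2, K x.1, x.2.1, x.2.2, 0) := by simp [start, hx]
      obtain ⟨n, hn, hi⟩ :=
        (savitchRun (N x.1) (E x.1) (K x.1) x.2.1 x.2.2 0 hx.1 hx.2).exists_iterate
      have hinv : SavitchInv (N x.1) (K x.1) (2, K x.1, x.2.1, x.2.2, 0) :=
        ⟨le_rfl, le_rfl, hx.1, hx.2, by simp⟩
      refine ⟨n, fun i hin => ?_, ?_, ?_, fun i hin => ?_⟩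
      · simp only [hs, hiter, cont, if_pos (hi i hin)]
        exact one_ne_zero
      · simp only [hs, hiter, cont, hn]
        split_ifs <;> simp_all
      · simp only [hs, hiter, hn, savitch_iff (hEN x.1) hx.1 (hNK x.1), hx.1, hx.2, true_and]
      · simp only [hs, hiter]
        exact hinv.iterate fun j hj => hi j (by omega)
    · have hs : start x = (x.1, 0, K x.1, 0, 0, 0) := by simp [start, hx]
      refine ⟨0, by simp, by simp [hs, cont], ?_, fun i hi => ?_⟩
      · rw [if_neg fun h => hx ⟨h.1, h.2.1⟩]; simp [hs]
      · obtain rfl : i = 0 := by omega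
        simp only [hs, iterate_zero, id_eq]
        exact ⟨by simp, le_rfl, hN0 _, hN0 _, by simp⟩
  choose n hn hn' hres hinv using hrun
  have hszN : PolyBound fun a => codeSize (N a) := hN.codeSize
  have hbound : PolyBound fun a => 100 * (K a + codeSize (N a) + (codeSize (N a) + 1) * K a + 1) :=
    (PolyBound.const 100).mul (((hK'.add hszN).add ((hszN.add (.const 1)).mul hK')).add (.const 1))
  have key := hstart.while_loop hstep hcont hn hn'
    (((PolyBound.codeSize.comp PS.fst.codeSize).add (hbound.comp PS.fst.codeSize)).add (.const 1)
      |>.mul (.const 2)) (fun x i hi => by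
        have h1 := codeSize_pair (step^[i] (start x)).1 (step^[i] (start x)).2
        have h2 := (hinv x i hi).codeSize_le
        have h3 : (step^[i] (start x)).1 = x.1 := by
          rw [show start x = ((start x).1, (start x).2) from rfl, hiter]
        rw [h3] at h1
        rw [show step^[i] (start x) = (x.1, (step^[i] (start x)).2) from Prod.ext h3 rfl]
        omega)
  exact .of_ite ((PS.fst' key.snd').of_enc fun x => by rw [hres])

open Classical in
theorem PSP.inPSPACE {L : Language Bool} (h : PSP fun x : List Bool => x ∈ L) : InPSPACE L := by
  -- `2` and `1` are the values of the one-digit numerals `[true]` and `[false]`, the encoded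
  -- Booleans.
  obtain ⟨P, bd, ⟨c, hc⟩, hP⟩ := PS.ite h (.const 2) (.const 1)
  -- The code of `x` has at most `x.length + 1` bits, so the bound is at most `(x.length + 3) ^ c`.
  refine Prog.inPSPACE (P 0) (c + 3) fun x B hB hx => ?_
  have h1 : codeSize x ≤ x.length + 1 :=
    Nat.size_le.2 (by have := numeralVal_add_two_le x; simp only [enc]; omega)
  have h2 : bd x ≤ B := by
    refine (hc x).trans (le_trans ?_ hB)
    exact (Nat.pow_le_pow_left (by omega) c).trans (Nat.pow_le_pow_right (by omega) (by omega))
  refine (hP x 0 B _ (by simp; rfl) (fun j hj => by simp [hj.ne']) hx h2).of_eq ?_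
  rw [update_idem]
  by_cases hL : x ∈ L <;> simp [hL, numeralVal, enc]

/-! ### Lists of bits -/

/-- Both `1 + 2 * t` and `2 + 2 * t` give `t` here, and truncated subtraction settles the empty
word. -/
theorem numeralVal_tail (x : List Bool) : numeralVal x.tail = (numeralVal x - 1) / 2 := by
  rcases x with _ | ⟨b, x⟩
  · rfl
  · cases b <;> simp [numeralVal]; omega

theorem codeSize_le_of_suffix {x y : List Bool} (h : x <:+ y) : codeSize x ≤ codeSize y := by
  obtain ⟨l, rfl⟩ := h
  refine Nat.size_le_size ?_
  induction l with
  | nil => rfl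
  | cons b l ih => exact ih.trans (by simp only [enc, List.cons_append, numeralVal]; omega)

theorem length_le_codeSize (x : List Bool) : x.length ≤ codeSize x := by
  have h1 := two_pow_length_le x
  have h2 : numeralVal x < 2 ^ codeSize x := Nat.lt_size_self _
  exact (Nat.pow_le_pow_iff_right (by norm_num : 1 < 2)).1 (h1.trans h2)

theorem PS.numeralVal : PS _root_.numeralVal :=
  (PS.id (α := List Bool)).of_enc (g := _root_.numeralVal) fun _ => rfl

theorem PS.tail {f : α → List Bool} (hf : PS f) : PS fun a => (f a).tail :=
  (((numeralVal.comp hf).sub (.const 1)).div (.const 2)).of_enc fun _ => (numeralVal_tail _).symm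

theorem PSP.eq_nil {f : α → List Bool} (hf : PS f) : PSP fun a => f a = [] :=
  (PSP.eq (PS.numeralVal.comp hf) (.const 0)).of_iff fun a => by
    constructor
    · intro h; rw [h]; rfl
    · intro h; exact numeralVal_injective h

/-- The lowest digit is 2 exactly when the value is even and nonzero. -/
theorem PSP.head_true {f : α → List Bool} (hf : PS f) : PSP fun a => (f a).head? = some Bool.true :=
  ((PSP.eq (PS.numeralVal.comp hf) (.const 0)).not.and
    (PSP.eq ((PS.numeralVal.comp hf).mod (.const 2)) (.const 0))).of_iff fun a => by
    rcases f a with _ | ⟨b, x⟩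
    · simp [numeralVal]
    · cases b <;> simp [numeralVal]

theorem iterate_suffix {g : List Bool → List Bool} (hs : ∀ x, g x <:+ x) (i : ℕ) (x : List Bool) :
    g^[i] x <:+ x := by
  induction i with
  | zero => exact List.suffix_rfl
  | succ i ih => rw [iterate_succ_apply']; exact (hs _).trans ih

/-- Iteration of a function that takes suffixes. -/
theorem PS.iterate_suffix {g : List Bool → List Bool} (hg : PS g) (hs : ∀ x, g x <:+ x)
    {f : α → List Bool} (hf : PS f) {n : α → ℕ} (hn : PS n) : PS fun a => g^[n a] (f a) :=
  PS.natRec (F := fun a i => g^[i] (f a)) (h := fun x => g x.2.2) hn hf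
    (hg.comp (.snd' .snd)) (fun _ _ _ => iterate_succ_apply' _ _ _) hf.codeSize fun a i _ => by
      refine codeSize_le_of_suffix ?_
      induction i with
      | zero => exact List.suffix_rfl
      | succ i ih => rw [iterate_succ_apply']; exact (hs _).trans (ih (by omega))

theorem PS.length {f : α → List Bool} (hf : PS f) : PS fun a => (f a).length := by
  have hdrop (x : List Bool) (k : ℕ) : List.tail^[k] x = x.drop k := by
    induction k with
    | zero => rfl
    | succ k ih => rw [iterate_succ_apply', ih, List.tail_drop]
  have hd {β : Type} [Coded β] {f : β → List Bool} {n : β → ℕ} (hf : PS f) (hn : PS n) :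
      PS fun a => (f a).drop (n a) :=
    ((PS.tail .id).iterate_suffix List.tail_suffix hf hn).of_enc fun _ => by rw [hdrop]
  -- The length is the least number of removals that empties the word, and it is below `2 ^ length`,
  -- hence at most the value of the word.
  refine PS.of_graph (PS.succ' (numeralVal.comp hf)) (fun a => ?_)
    (((PSP.eq_nil (hd (hf.comp .fst) .snd)).and (PSP.forall_lt
      (p := fun x j => ¬ (f x.1).drop j = []) .snd (PSP.eq_nil (hd (hf.comp (.fst' .fst)) .snd)).not)).of_iff fun x => ?_)
  · have h1 := two_pow_length_le (f a)
    have h2 : (f a).length < 2 ^ (f a).length := Nat.lt_two_pow_self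
    omega
  · simp only [List.drop_eq_nil_iff, not_le]
    constructor
    · rintro h; rw [h]; exact ⟨le_rfl, fun _ h => h⟩
    · rintro ⟨h1, h2⟩
      by_contra h
      have := h2 (f x.1).length (by omega)
      omega

/-- The list without its leading `true`s. -/
def dropTrue (x : List Bool) : List Bool :=
  x.dropWhile id

theorem PS.dropTrue {f : α → List Bool} (hf : PS f) : PS fun a => dropTrue (f a) := by
  classical
  -- One round of `dropWhile`; it becomes stationary at the first `false`, so as many rounds as the
  -- word is long suffice.
  let g : List Bool → List Bool := fun x => if x.head? = some true then x.tail else x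
  have hg : PS g := .ite (.head_true .id) (.tail .id) .id
  have hgs (x : List Bool) : g x <:+ x := by
    simp only [g]
    split_ifs
    exacts [List.tail_suffix x, List.suffix_rfl]
  have key (x : List Bool) (n : ℕ) (hn : x.length ≤ n) : g^[n] x = _root_.dropTrue x := by
    induction n generalizing x with
    | zero =>
      obtain rfl : x = [] := List.length_eq_zero_iff.1 (by omega)
      rfl
    | succ n ih =>
      rw [iterate_succ_apply]
      rcases x with _ | ⟨b, x⟩
      · exact ih [] (by simp)
      · cases b
        · have h1 : g (false :: x) = false :: x := by simp [g]
          rw [h1]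
          clear ih hn
          induction n with
          | zero => rfl
          | succ n ih => rw [iterate_succ_apply, h1, ih]
        · have h1 : g (true :: x) = x := by simp [g]
          rw [h1, ih x (by simpa using hn)]
          rfl
  exact (hg.iterate_suffix hgs hf (PS.length hf)).of_enc fun a => by rw [key _ _ le_rfl]

/-! ### Lists of numbers in unary -/

/-- The list without its first unary number. -/
def restNums (x : List Bool) : List Bool :=
  (dropTrue x).tail

/-- The first unary number. -/
def headNum (x : List Bool) : ℕ :=
  x.length - (dropTrue x).length

/-- The unary number at position `j`. -/
def num (x : List Bool) (j : ℕ) : ℕ :=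
  headNum (restNums^[j] x)

/-- The list consists of exactly `n` unary numbers. -/
def IsNums (x : List Bool) (n : ℕ) : Prop :=
  (∀ i < n, dropTrue (restNums^[i] x) ≠ []) ∧ restNums^[n] x = []

theorem restNums_suffix (x : List Bool) : restNums x <:+ x :=
  (List.tail_suffix _).trans (List.dropWhile_suffix _)

theorem PS.restNums_iterate {f : α → List Bool} {n : α → ℕ} (hf : PS f) (hn : PS n) :
    PS fun a => restNums^[n a] (f a) :=
  (PS.tail (.dropTrue .id)).iterate_suffix restNums_suffix hf hn

theorem PS.num {f : α → List Bool} {n : α → ℕ} (hf : PS f) (hn : PS n) :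
    PS fun a => num (f a) (n a) :=
  (PS.length (restNums_iterate hf hn)).sub (.length (.dropTrue (restNums_iterate hf hn)))

theorem PSP.isNums {f : α → List Bool} {n : α → ℕ} (hf : PS f) (hn : PS n) :
    PSP fun a => IsNums (f a) (n a) :=
  (forall_lt hn (PSP.eq_nil (.dropTrue (.restNums_iterate (hf.comp .fst) .snd))).not).and
    (PSP.eq_nil (.restNums_iterate hf hn))

theorem num_le_codeSize (x : List Bool) (j : ℕ) : num x j ≤ codeSize x := by
  have := (iterate_suffix restNums_suffix j x).length_le
  exact ((Nat.sub_le _ _).trans this).trans (length_le_codeSize x)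

theorem dropTrue_append (a : ℕ) (x : List Bool) :
    dropTrue (List.replicate a true ++ false :: x) = false :: x := by
  induction a with
  | zero => rfl
  | succ a ih => exact ih

theorem encodeNums_cons (a : ℕ) (l : List ℕ) :
    encodeNums (a :: l) = List.replicate a true ++ false :: encodeNums l := by
  simp [encodeNums]

/-- Reading past the end is harmless, as `restNums` fixes the empty word; this matches the default
`0` in `num_encodeNums`. -/
theorem restNums_encodeNums (j : ℕ) (l : List ℕ) :
    restNums^[j] (encodeNums l) = encodeNums (l.drop j) := by
  induction j generalizing l with
  | zero => rfl
  | succ j ih =>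
    rw [iterate_succ_apply]
    rcases l with _ | ⟨a, l⟩
    · rw [show restNums (encodeNums []) = encodeNums [] from rfl, ih]; simp
    · rw [encodeNums_cons, restNums, dropTrue_append]
      exact ih l

theorem num_encodeNums (j : ℕ) (l : List ℕ) : num (encodeNums l) j = l.getD j 0 := by
  rw [num, restNums_encodeNums, List.getD_eq_getElem?_getD, ← List.head?_drop]
  rcases l.drop j with _ | ⟨a, m⟩
  · rfl
  · simp [encodeNums_cons, headNum, dropTrue_append]

theorem isNums_encodeNums (l : List ℕ) : IsNums (encodeNums l) l.length := by
  refine ⟨fun i hi => ?_, ?_⟩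
  · rw [restNums_encodeNums, List.drop_eq_getElem_cons hi, encodeNums_cons, dropTrue_append]
    simp
  · rw [restNums_encodeNums, List.drop_length]; rfl

/-- Every number has its terminating `false` and nothing is left over, so rewriting the numbers read
off gives back the word. -/
theorem IsNums.eq_encodeNums {x : List Bool} {n : ℕ} (h : IsNums x n) :
    encodeNums ((List.range n).map (num x)) = x := by
  induction n generalizing x with
  | zero => exact h.2.symm
  | succ n ih =>
    rw [List.range_succ_eq_map, List.map_cons, List.map_map, encodeNums_cons]
    have h1 : encodeNums ((List.range n).map (num (restNums x))) = restNums x :=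
      ih ⟨fun i hi => h.1 (i + 1) (by omega), h.2⟩
    have h2 : num x ∘ Nat.succ = num (restNums x) := rfl
    rw [h2, h1]
    have h3 : dropTrue x ≠ [] := h.1 0 (Nat.succ_pos n)
    have h4 : x.takeWhile id = List.replicate (num x 0) true := by
      rw [List.eq_replicate_iff]
      refine ⟨?_, fun b hb => by simpa using List.mem_takeWhile_imp hb⟩
      have := congrArg List.length (List.takeWhile_append_dropWhile (p := id) (l := x))
      rw [List.length_append] at this
      change _ = headNum x
      rw [headNum, dropTrue]
      omega
    have h5 : dropTrue x = false :: restNums x := by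
      have h6 : (dropTrue x).head h3 = false := List.head_dropWhile_not (l := x) id h3
      rw [restNums, ← h6, List.cons_head_tail]
    rw [← h4, ← h5, dropTrue, List.takeWhile_append_dropWhile]

/-! ### Reading the description of an automaton -/

theorem getD_append_of_eq {l l' : List ℕ} {i n : ℕ} (h : i = l.length + n) :
    (l ++ l').getD i 0 = l'.getD n 0 := by
  rw [h, List.getD_append_right _ _ _ _ (Nat.le_add_right _ _), Nat.add_sub_cancel_left]

/-- Random access to a table: as all rows have length `m`, row `q` begins at `q * m`.
`flatMap_range_map` is the converse, cutting a range of indices into rows. -/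
theorem getD_flatMap {n m : ℕ} (f : Fin n → List ℕ) (hf : ∀ q, (f q).length = m) (q : Fin n)
    {i : ℕ} (hi : i < m) :
    ((List.finRange n).flatMap f).getD (q * m + i) 0 = (f q).getD i 0 := by
  induction n with
  | zero => exact q.elim0
  | succ n ih =>
    rw [List.finRange_succ, List.flatMap_cons, List.flatMap_map]
    refine Fin.cases ?_ (fun q => ?_) q
    · rw [List.getD_append _ _ _ _ (by simpa [hf] using hi)]
      simp
    · rw [List.getD_append_right _ _ _ _ (by rw [hf, Fin.val_succ, Nat.succ_mul]; omega), hf,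
        ← ih (fun q => f q.succ) (fun q => hf _) q]
      congr 1
      rw [Fin.val_succ, Nat.succ_mul]
      omega

theorem flatMap_range_map (n m : ℕ) (g : ℕ → ℕ) :
    ((List.finRange n).flatMap fun q : Fin n => (List.range m).map fun i => g ((q : ℕ) * m + i)) =
      (List.range (n * m)).map g := by
  have h1 := (List.flatMap_map (Fin.val (n := n))
    (fun q => (List.range m).map fun i => g (q * m + i)) (l := List.finRange n)).symm
  refine h1.trans ?_
  rw [List.map_coe_finRange_eq_range]
  clear h1
  induction n with
  | zero => simp
  | succ n ih =>
    rw [List.range_succ, List.flatMap_append, ih, Nat.succ_mul, List.range_add, List.map_append]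
    simp

/-- The number of states in a description; similarly for the other components. -/
def numQ (x : List Bool) : ℕ := num x 0

/-- The number of call letters in a description. -/
def numC (x : List Bool) : ℕ := num x 1

/-- The number of internal letters in a description. -/
def numI (x : List Bool) : ℕ := num x 2

/-- The number of return letters in a description. -/
def numR (x : List Bool) : ℕ := num x 3

/-- The number of stack symbols other than the bottom symbol in a description. -/
def numG (x : List Bool) : ℕ := num x 4

/-- The new state after a call letter in a description. -/
def callQ (x : List Bool) (q a : ℕ) : ℕ :=
  num x (5 + (q * (numC x * 2) + (a * 2 + 0)))

/-- The pushed symbol in a description. -/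
def callG (x : List Bool) (q a : ℕ) : ℕ :=
  num x (5 + (q * (numC x * 2) + (a * 2 + 1)))

/-- The new state after an internal letter in a description. -/
def intQ (x : List Bool) (q a : ℕ) : ℕ :=
  num x (5 + numQ x * (numC x * 2) + (q * numI x + a))

/-- The new state after a return letter in a description, where `j` is `0` for the bottom symbol
and `g + 1` for the stack symbol `g`. -/
def retQ (x : List Bool) (q a j : ℕ) : ℕ :=
  num x (5 + numQ x * (numC x * 2) + numQ x * numI x +
    (q * (numR x * (numG x + 1)) + (a * (numG x + 1) + j)))

/-- The string describes an automaton. -/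
def IsDescription (x : List Bool) : Prop :=
  IsNums x (5 + numQ x * (numC x * 2) + numQ x * numI x + numQ x * (numR x * (numG x + 1))) ∧
  (∀ q < numQ x, ∀ a < numC x, callQ x q a < numQ x ∧ callG x q a < numG x) ∧
  (∀ q < numQ x, ∀ a < numI x, intQ x q a < numQ x) ∧
  (∀ q < numQ x, ∀ a < numR x, ∀ j < numG x + 1, retQ x q a j < numQ x)

/-! ### Agreement of automata with their descriptions -/

namespace CodedDVPDA

variable (M : CodedDVPDA)

theorem length_toNums : M.toNums.length = 5 + M.nQ * (M.nC * 2) + M.nQ * M.nI +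
    M.nQ * (M.nR * (M.nG + 1)) := by
  simp [toNums, List.length_flatMap]
  ring

theorem num_encode (j : ℕ) : num M.encode j = M.toNums.getD j 0 :=
  num_encodeNums _ _

theorem numQ_encode : numQ M.encode = M.nQ := by simp [numQ, num_encode, toNums]

theorem numC_encode : numC M.encode = M.nC := by simp [numC, num_encode, toNums]

theorem numI_encode : numI M.encode = M.nI := by simp [numI, num_encode, toNums]

theorem numR_encode : numR M.encode = M.nR := by simp [numR, num_encode, toNums]

theorem numG_encode : numG M.encode = M.nG := by simp [numG, num_encode, toNums]

theorem lt_mul_of_lt {n m q i : ℕ} (hq : q < n) (hi : i < m) : q * m + i < n * m := by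
  have : (q + 1) * m ≤ n * m := Nat.mul_le_mul_right _ hq
  rw [Nat.succ_mul] at this
  omega

theorem num_call (q : Fin M.nQ) (a : Fin M.nC) {j : ℕ} (hj : j < 2) :
    num M.encode (5 + (q * (M.nC * 2) + (a * 2 + j))) =
      [((M.aut.callStep q a).1 : ℕ), ((M.aut.callStep q a).2 : ℕ)].getD j 0 := by
  have h1 := lt_mul_of_lt a.2 hj
  have h2 := lt_mul_of_lt q.2 h1
  rw [num_encode, toNums, List.append_assoc, List.append_assoc,
    getD_append_of_eq (i := 5 + _) (n := q * (M.nC * 2) + (a * 2 + j)) (by simp),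
    List.getD_append _ _ _ _ (by simpa [List.length_flatMap] using h2),
    getD_flatMap _ (by simp [List.length_flatMap]) q h1,
    getD_flatMap _ (by simp) a hj]

theorem callQ_encode (q : Fin M.nQ) (a : Fin M.nC) :
    callQ M.encode q a = (M.aut.callStep q a).1 := by
  rw [callQ, numC_encode, num_call _ _ _ (by norm_num)]; rfl

theorem callG_encode (q : Fin M.nQ) (a : Fin M.nC) :
    callG M.encode q a = (M.aut.callStep q a).2 := by
  rw [callG, numC_encode, num_call _ _ _ (by norm_num)]; rfl

theorem intQ_encode (q : Fin M.nQ) (a : Fin M.nI) :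
    intQ M.encode q a = M.aut.intStep q a := by
  have h2 := lt_mul_of_lt q.2 a.2
  rw [intQ, numQ_encode, numC_encode, numI_encode, num_encode, toNums, List.append_assoc,
    getD_append_of_eq (n := q * M.nI + a) (by simp [List.length_flatMap]; omega),
    List.getD_append _ _ _ _ (by simpa [List.length_flatMap] using h2),
    getD_flatMap _ (by simp) q a.2]
  simp

theorem retQ_encode (q : Fin M.nQ) (a : Fin M.nR) {j : ℕ} (hj : j < M.nG + 1) :
    retQ M.encode q a j = ((M.aut.retStep q a none : ℕ) ::
      (List.finRange M.nG).map fun g => (M.aut.retStep q a (some g) : ℕ)).getD j 0 := by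
  have h1 := lt_mul_of_lt a.2 hj
  rw [retQ, numQ_encode, numC_encode, numI_encode, numR_encode, numG_encode, num_encode, toNums,
    getD_append_of_eq (n := q * (M.nR * (M.nG + 1)) + (a * (M.nG + 1) + j))
      (by simp [List.length_flatMap]; omega),
    getD_flatMap _ (by simp [List.length_flatMap]) q h1,
    getD_flatMap _ (by simp) a hj]

theorem isDescription_encode : IsDescription M.encode := by
  rw [IsDescription, numQ_encode, numC_encode, numI_encode, numR_encode, numG_encode]
  refine ⟨?_, fun q hq a ha => ?_, fun q hq a ha => ?_, fun q hq a ha j hj => ?_⟩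
  · rw [← length_toNums]
    exact isNums_encodeNums _
  · have h1 := M.callQ_encode ⟨q, hq⟩ ⟨a, ha⟩
    have h2 := M.callG_encode ⟨q, hq⟩ ⟨a, ha⟩
    simp only at h1 h2
    rw [h1, h2]
    exact ⟨Fin.is_lt _, Fin.is_lt _⟩
  · have h1 := M.intQ_encode ⟨q, hq⟩ ⟨a, ha⟩
    simp only at h1
    rw [h1]
    exact Fin.is_lt _
  · have h1 := M.retQ_encode ⟨q, hq⟩ ⟨a, ha⟩ hj
    simp only at h1
    rw [h1]
    rcases j with _ | j
    · exact Fin.is_lt _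
    · rw [List.getD_cons_succ, List.getD_eq_getElem _ _ (by simpa using hj)]
      simp

/-- The automaton with a given description. -/
def decode (x : List Bool) (h : IsDescription x) : CodedDVPDA where
  nQ := numQ x
  nC := numC x
  nI := numI x
  nR := numR x
  nG := numG x
  aut :=
    { callStep := fun q a => (⟨callQ x q a, (h.2.1 q q.2 a a.2).1⟩, ⟨callG x q a, (h.2.1 q q.2 a a.2).2⟩)
      intStep := fun q a => ⟨intQ x q a, h.2.2.1 q q.2 a a.2⟩
      retStep := fun q a o => ⟨retQ x q a (match o with | none => 0 | some g => g + 1),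
        h.2.2.2 q q.2 a a.2 _ (by rcases o with _ | g <;> simp)⟩ }

/-- With `isDescription_encode`, this makes `IsDescription` the exact range of `encode`; the
existential over automata in the problems becomes a test on the word. -/
theorem encode_decode (x : List Bool) (h : IsDescription x) : (decode x h).encode = x := by
  have h1 := h.1.eq_encodeNums
  rw [encode]
  refine Eq.trans (congrArg encodeNums ?_) h1
  rw [List.range_add, List.range_add, List.range_add, List.map_append, List.map_append,
    List.map_append, List.map_map, List.map_map, List.map_map, toNums]
  refine congrArg₂ _ (congrArg₂ _ (congrArg₂ _ ?_ ?_) ?_) ?_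
  · rfl
  · rw [← flatMap_range_map]
    refine List.flatMap_congr fun q _ => ?_
    have := flatMap_range_map (numC x) 2 fun i => num x (5 + (q * (numC x * 2) + i))
    exact Eq.trans rfl this
  · rw [← flatMap_range_map]
    refine List.flatMap_congr fun q _ => ?_
    rw [← List.map_coe_finRange_eq_range, List.map_map]
    rfl
  · rw [← flatMap_range_map]
    refine List.flatMap_congr fun q _ => ?_
    have := flatMap_range_map (numR x) (numG x + 1) fun i =>
      num x (5 + numQ x * (numC x * 2) + numQ x * numI x + (q * (numR x * (numG x + 1)) + i))
    refine Eq.trans ?_ this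
    refine List.flatMap_congr fun a _ => ?_
    rw [List.range_succ_eq_map, List.map_cons, List.map_map, ← List.map_coe_finRange_eq_range,
      List.map_map]
    rfl

end CodedDVPDA

/-! ### Synchronization by one stroke as reachability between sets of states -/

namespace DVPDA

variable {Q C I R G : Type*} (M : DVPDA Q C I R G)

theorem run_cons (c : Q × List G) (a : VLetter C I R) (w : List (VLetter C I R)) :
    M.run c (a :: w) = M.run (M.step c a) w := rfl

theorem run_append (c : Q × List G) (u v : List (VLetter C I R)) :
    M.run c (u ++ v) = M.run (M.run c u) v := List.foldl_append

theorem isUpstroke_nil (c : Q × List G) : M.IsUpstroke c [] := by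
  intro u a v h; simp at h

theorem isUpstroke_cons {c : Q × List G} {a : VLetter C I R} {w : List (VLetter C I R)} :
    M.IsUpstroke c (a :: w) ↔
      c.2.length ≤ (M.step c a).2.length ∧ M.IsUpstroke (M.step c a) w := by
  refine ⟨fun h => ⟨h [] a w rfl, fun u b v e => h (a :: u) b v (by rw [e]; rfl)⟩, ?_⟩
  rintro ⟨h1, h2⟩ (_ | ⟨b, u⟩) d v e
  · obtain ⟨rfl, rfl⟩ := List.cons_eq_cons.1 e
    exact h1
  · obtain ⟨rfl, rfl⟩ := List.cons_eq_cons.1 e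
    exact h2 u d v rfl

theorem isDownstroke_cons {c : Q × List G} {a : VLetter C I R} {w : List (VLetter C I R)}
    (h : M.IsDownstroke c (a :: w)) :
    (M.step c a).2.length ≤ c.2.length ∧ M.IsDownstroke (M.step c a) w :=
  ⟨h [] a w rfl, fun u b v e => h (a :: u) b v (by rw [e]; rfl)⟩

theorem atMostStrokes_one {c : Q × List G} {w : List (VLetter C I R)} :
    M.AtMostStrokes 1 c w ↔ M.IsStroke c w := by
  constructor
  · rintro ⟨u, v, rfl, h, rfl⟩
    simpa using h
  · exact fun h => ⟨w, [], by simp, h, rfl⟩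

/-- A run with empty stack never leaves the empty stack on a downstroke. -/
theorem IsDownstroke.isUpstroke {q : Q} {w : List (VLetter C I R)}
    (h : M.IsDownstroke (q, []) w) : M.IsUpstroke (q, []) w := by
  induction w generalizing q with
  | nil => exact M.isUpstroke_nil _
  | cons a w ih =>
    obtain ⟨h1, h2⟩ := M.isDownstroke_cons h
    rw [isUpstroke_cons]
    rcases a with a | a | a
    · simp [step] at h1
    · exact ⟨le_rfl, ih h2⟩
    · exact ⟨le_rfl, ih h2⟩

theorem isUpstroke_of_no_ret {c : Q × List G} {w : List (VLetter C I R)}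
    (h : ∀ b, VLetter.ret b ∉ w) : M.IsUpstroke c w := by
  induction w generalizing c with
  | nil => exact M.isUpstroke_nil _
  | cons a w ih =>
    rw [isUpstroke_cons]
    refine ⟨?_, ih fun b hb => h b (List.mem_cons_of_mem _ hb)⟩
    rcases a with a | a | a
    · simp [step]
    · simp [step]
    · exact absurd List.mem_cons_self (h a)

theorem isUpstroke_append {q : Q} {u v : List (VLetter C I R)}
    (hu : ∀ a, VLetter.call a ∉ u) (hv : ∀ b, VLetter.ret b ∉ v) :
    M.IsUpstroke (q, []) (u ++ v) := by
  induction u generalizing q with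
  | nil => exact M.isUpstroke_of_no_ret hv
  | cons a u ih =>
    rw [List.cons_append, isUpstroke_cons]
    rcases a with a | a | a
    · exact absurd List.mem_cons_self (hu a)
    · exact ⟨le_rfl, ih fun b hb => hu b (List.mem_cons_of_mem _ hb)⟩
    · exact ⟨le_rfl, ih fun b hb => hu b (List.mem_cons_of_mem _ hb)⟩

/-- On an upstroke a nonempty stack stays nonempty, and there a return letter would pop. -/
theorem IsUpstroke.no_ret {c : Q × List G} {w : List (VLetter C I R)} (h : M.IsUpstroke c w)
    (hc : c.2 ≠ []) : ∀ b, VLetter.ret b ∉ w := by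
  induction w generalizing c with
  | nil => simp
  | cons a w ih =>
    obtain ⟨h1, h2⟩ := M.isUpstroke_cons.1 h
    have h3 : 0 < c.2.length := List.length_pos_iff.2 hc
    have h4 := ih h2 (List.length_pos_iff.1 (h3.trans_le h1))
    intro b hb
    rcases List.mem_cons.1 hb with rfl | hb
    · obtain ⟨q, _ | ⟨g, s⟩⟩ := c
      · exact hc rfl
      · simp [step] at h1
    · exact h4 b hb

/-- The number `n` of pushed symbols depends on the word alone, not on the run, so the final stacks
of different runs can be compared position by position. -/
theorem exists_run_eq_append (w : List (VLetter C I R)) (h : ∀ b, VLetter.ret b ∉ w) :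
    ∃ n, ∀ c : Q × List G, ∃ r, r.length = n ∧ (M.run c w).2 = r ++ c.2 := by
  induction w with
  | nil => exact ⟨0, fun c => ⟨[], rfl, rfl⟩⟩
  | cons a w ih =>
    obtain ⟨n, hn⟩ := ih fun b hb => h b (List.mem_cons_of_mem _ hb)
    rcases a with a | a | a
    · refine ⟨n + 1, fun c => ?_⟩
      obtain ⟨r, h1, h2⟩ := hn (M.step c (.call a))
      exact ⟨r ++ [(M.callStep c.1 a).2], by simp [h1], by rw [run_cons, h2]; simp [step]⟩
    · exact ⟨n, fun c => hn (M.step c (.int a))⟩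
    · exact absurd List.mem_cons_self (h a)

/-! ### Flat and rising edges between sets of states -/

/-- The change of a set of states by a letter that is not a call letter, with empty stack. -/
def FlatEdge (U V : Set Q) : Prop :=
  (∃ a, V = (M.intStep · a) '' U) ∨ ∃ a, V = (M.retStep · a none) '' U

/-- The change of a set of states by a letter that is not a return letter and, if it is a call
letter, lets all states in the set push the same symbol. -/
def RiseEdge (U V : Set Q) : Prop :=
  (∃ a, V = (M.intStep · a) '' U) ∨
    ∃ a, V = (fun q => (M.callStep q a).1) '' U ∧
      ∀ p ∈ U, ∀ q ∈ U, (M.callStep p a).2 = (M.callStep q a).2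

theorem exists_word_of_flat {U : Set Q} (h : Relation.ReflTransGen M.FlatEdge Set.univ U) :
    ∃ w : List (VLetter C I R), (∀ a, VLetter.call a ∉ w) ∧
      ∃ f : Q → Q, U = Set.range f ∧ ∀ q, M.run (q, []) w = (f q, []) := by
  induction h with
  | refl => exact ⟨[], by simp, _root_.id, by simp, fun _ => rfl⟩
  | tail _ h ih =>
    obtain ⟨w, hw, f, rfl, hf⟩ := ih
    rcases h with ⟨a, rfl⟩ | ⟨a, rfl⟩
    · refine ⟨w ++ [.int a], by simpa using hw, (M.intStep · a) ∘ f, by rw [Set.range_comp],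
        fun q => ?_⟩
      rw [run_append, hf]; rfl
    · refine ⟨w ++ [.ret a], by simpa using hw, (M.retStep · a none) ∘ f, by rw [Set.range_comp],
        fun q => ?_⟩
      rw [run_append, hf]; rfl

theorem exists_word_of_rise {U V : Set Q} (hU : U.Nonempty)
    (h : Relation.ReflTransGen M.RiseEdge U V) :
    ∃ w : List (VLetter C I R), (∀ b, VLetter.ret b ∉ w) ∧
      ∃ (f : Q → Q) (s : List G), V = f '' U ∧ ∀ q ∈ U, M.run (q, []) w = (f q, s) := by
  induction h with
  | refl => exact ⟨[], by simp, _root_.id, [], by simp, fun _ _ => rfl⟩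
  | tail _ h ih =>
    obtain ⟨w, hw, f, s, rfl, hf⟩ := ih
    rcases h with ⟨a, rfl⟩ | ⟨a, rfl, ha⟩
    · refine ⟨w ++ [.int a], by simpa using hw, (M.intStep · a) ∘ f, s, by rw [Set.image_comp],
        fun q hq => ?_⟩
      rw [run_append, hf q hq]; rfl
    -- A member of `U` is needed to name the common pushed symbol.
    · obtain ⟨p, hp⟩ := hU
      refine ⟨w ++ [.call a], by simpa using hw, (fun q => (M.callStep q a).1) ∘ f,
        (M.callStep (f p) a).2 :: s, by rw [Set.image_comp], fun q hq => ?_⟩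
      rw [run_append, hf q hq, ha _ (Set.mem_image_of_mem f hp) _ (Set.mem_image_of_mem f hq)]
      rfl

/-- The symbol pushed by the first call letter is never popped and ends up under the same number of
symbols in all runs; equal final stacks thus force equal pushed symbols. The initial stack `t` is
arbitrary but common, as the induction needs. -/
theorem rise_of_run {w : List (VLetter C I R)} (hw : ∀ b, VLetter.ret b ∉ w) {U : Set Q}
    (hU : U.Nonempty) {p : Q} {s t : List G} (h : ∀ q ∈ U, M.run (q, t) w = (p, s)) :
    Relation.ReflTransGen M.RiseEdge U {p} := by
  induction w generalizing U t with
  | nil =>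
    have : U = {p} := hU.subset_singleton_iff.1 fun q hq => (Prod.ext_iff.1 (h q hq)).1
    rw [this]
  | cons a w ih =>
    have hw' : ∀ b, VLetter.ret b ∉ w := fun b hb => hw b (List.mem_cons_of_mem _ hb)
    rcases a with a | a | a
    · obtain ⟨n, hn⟩ := M.exists_run_eq_append w hw'
      have hs : ∀ q ∈ U, ∃ r : List G, r.length = n ∧ s = r ++ (M.callStep q a).2 :: t := by
        intro q hq
        obtain ⟨r, h1, h2⟩ := hn (M.step (q, t) (.call a))
        refine ⟨r, h1, ?_⟩
        rw [← run_cons, h q hq] at h2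
        exact h2
      have ha : ∀ q ∈ U, ∀ q' ∈ U, (M.callStep q a).2 = (M.callStep q' a).2 := by
        intro q hq q' hq'
        obtain ⟨r, h1, h2⟩ := hs q hq
        obtain ⟨r', h1', h2'⟩ := hs q' hq'
        have := (List.append_inj (h2.symm.trans h2') (h1.trans h1'.symm)).2
        exact (List.cons_eq_cons.1 this).1
      refine .head (.inr ⟨a, rfl, ha⟩) ?_
      obtain ⟨q₀, hq₀⟩ := hU
      refine ih hw' (Set.Nonempty.image _ ⟨q₀, hq₀⟩) (t := (M.callStep q₀ a).2 :: t) ?_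
      rintro _ ⟨q, hq, rfl⟩
      rw [ha q₀ hq₀ q hq]
      exact h q hq
    · refine .head (.inl ⟨a, rfl⟩) (ih hw' (hU.image _) (t := t) ?_)
      rintro _ ⟨q, hq, rfl⟩
      exact h q hq
    · exact absurd List.mem_cons_self (hw a)

/-- Letters before the first call letter act on the empty stack and give flat edges. After a call
letter the stack is nonempty, so the rest of the upstroke has no return letter and `rise_of_run`
applies. -/
theorem flat_rise_of_run {w : List (VLetter C I R)} {U : Set Q} (hU : U.Nonempty) {p : Q}
    {s : List G} (hu : ∀ q ∈ U, M.IsUpstroke (q, []) w)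
    (h : ∀ q ∈ U, M.run (q, []) w = (p, s)) :
    ∃ V, Relation.ReflTransGen M.FlatEdge U V ∧ Relation.ReflTransGen M.RiseEdge V {p} := by
  induction w generalizing U with
  | nil => exact ⟨U, .refl, M.rise_of_run (by simp) hU h⟩
  | cons a w ih =>
    rcases a with a | a | a
    · refine ⟨U, .refl, M.rise_of_run ?_ hU h⟩
      obtain ⟨q, hq⟩ := hU
      have := IsUpstroke.no_ret M (M.isUpstroke_cons.1 (hu q hq)).2 (List.cons_ne_nil _ _)
      simpa using this
    · obtain ⟨V, h1, h2⟩ := ih (hU.image (M.intStep · a))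
        (by rintro _ ⟨q, hq, rfl⟩; exact (M.isUpstroke_cons.1 (hu q hq)).2)
        (by rintro _ ⟨q, hq, rfl⟩; exact h q hq)
      exact ⟨V, .head (.inl ⟨a, rfl⟩) h1, h2⟩
    · obtain ⟨V, h1, h2⟩ := ih (hU.image (M.retStep · a none))
        (by rintro _ ⟨q, hq, rfl⟩; exact (M.isUpstroke_cons.1 (hu q hq)).2)
        (by rintro _ ⟨q, hq, rfl⟩; exact h q hq)
      exact ⟨V, .head (.inr ⟨a, rfl⟩) h1, h2⟩

theorem exists_turnSyncSame_zero_iff : (∃ w, M.TurnSyncSame 0 w) ↔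
    ∃ (U : Set Q) (p : Q), Relation.ReflTransGen M.FlatEdge Set.univ U ∧
      Relation.ReflTransGen M.RiseEdge U {p} := by
  constructor
  · rintro ⟨w, ⟨p, s, h⟩, hw⟩
    obtain ⟨V, hV⟩ := M.flat_rise_of_run (U := Set.univ) (Set.nonempty_of_mem (Set.mem_univ p))
      (fun q _ => (M.atMostStrokes_one.1 (hw q)).elim _root_.id (IsDownstroke.isUpstroke M))
      (fun q _ => h q)
    exact ⟨V, p, hV⟩
  · rintro ⟨U, p, h1, h2⟩
    obtain ⟨u, hu, f, rfl, hf⟩ := M.exists_word_of_flat h1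
    obtain ⟨v, hv, g, s, hg, hgs⟩ := M.exists_word_of_rise (Set.nonempty_of_mem (Set.mem_range_self p)) h2
    refine ⟨u ++ v, ⟨p, s, fun q => ?_⟩,
      fun q => M.atMostStrokes_one.2 (.inl (M.isUpstroke_append hu hv))⟩
    have h3 : g (f q) = p :=
      Set.mem_singleton_iff.1 (hg ▸ Set.mem_image_of_mem g (Set.mem_range_self q))
    rw [run_append, hf, hgs _ (Set.mem_range_self q), h3]

theorem NoReturn.turnSyncSame_zero_iff (h : M.NoReturn) (w : List (VLetter C I R)) :
    M.TurnSyncSame 0 w ↔ M.SyncSame w :=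
  ⟨And.left, fun hw => ⟨hw, fun _ => M.atMostStrokes_one.2
    (.inl (M.isUpstroke_of_no_ret fun b => (h.false b).elim))⟩⟩

end DVPDA

/-! ### Sets of states as numbers -/

/-- The set of the positions below `n` that hold a one in the binary expansion of `U`. -/
def bitSet (n U : ℕ) : Set (Fin n) :=
  {q | U.testBit q = true}

theorem bitSet_injOn {n U V : ℕ} (hU : U < 2 ^ n) (hV : V < 2 ^ n) (h : bitSet n U = bitSet n V) :
    U = V := by
  refine Nat.eq_of_testBit_eq fun i => ?_
  by_cases hi : i < n
  · have := Set.ext_iff.1 h ⟨i, hi⟩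
    exact Bool.eq_iff_iff.2 this
  · have hp : 2 ^ n ≤ 2 ^ i := Nat.pow_le_pow_right (by norm_num) (by omega)
    rw [Nat.testBit_lt_two_pow (hU.trans_le hp), Nat.testBit_lt_two_pow (hV.trans_le hp)]

open Classical in
theorem exists_bitSet_eq {n : ℕ} (S : Set (Fin n)) : ∃ U < 2 ^ n, bitSet n U = S := by
  refine ⟨Nat.ofBits fun q => decide (q ∈ S), Nat.ofBits_lt_two_pow _, ?_⟩
  ext q
  simp [bitSet, Nat.testBit_ofBits_lt]

theorem bitSet_two_pow_sub_one (n : ℕ) : bitSet n (2 ^ n - 1) = Set.univ := by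
  ext q
  simp [bitSet, Nat.testBit_two_pow_sub_one]

theorem bitSet_two_pow {n : ℕ} (p : Fin n) : bitSet n (2 ^ (p : ℕ)) = {p} := by
  ext q
  simp [bitSet, Nat.testBit_two_pow, Fin.ext_iff, eq_comm]

/-- Every set has exactly one number below `2 ^ n`, so a walk of sets lifts step by step to numbers,
and the number of its last set is forced to be `V`. -/
theorem reflTransGen_bitSet {n : ℕ} {r : ℕ → ℕ → Prop} {R : Set (Fin n) → Set (Fin n) → Prop}
    (h : ∀ U V, r U V ↔ V < 2 ^ n ∧ R (bitSet n U) (bitSet n V)) {U V : ℕ} (hV : V < 2 ^ n)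
    (hU : U < 2 ^ n) :
    Relation.ReflTransGen r U V ↔ Relation.ReflTransGen R (bitSet n U) (bitSet n V) := by
  refine ⟨fun hr => hr.lift _ fun a b hab => ((h a b).1 hab).2, fun hr => ?_⟩
  have key : ∀ S, Relation.ReflTransGen R (bitSet n U) S →
      ∃ W < 2 ^ n, bitSet n W = S ∧ Relation.ReflTransGen r U W := by
    intro S hS
    induction hS with
    | refl => exact ⟨U, hU, rfl, .refl⟩
    | @tail _ T _ hST ih =>
      obtain ⟨W, _, rfl, hW⟩ := ih
      obtain ⟨W', hW', rfl⟩ := exists_bitSet_eq T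
      exact ⟨W', hW', rfl, hW.tail ((h _ _).2 ⟨hW', hST⟩)⟩
  obtain ⟨W, hW, hWV, hUW⟩ := key _ hr
  rwa [← bitSet_injOn hW hV hWV]

/-- The set coded by `V` is the image of the set coded by `U`. -/
def IsImage (n : ℕ) (f : ℕ → ℕ) (U V : ℕ) : Prop :=
  V < 2 ^ n ∧ ∀ p < n, V.testBit p = true ↔ ∃ q < n, U.testBit q = true ∧ f q = p

theorem isImage_iff {n U V : ℕ} {f : ℕ → ℕ} {F : Fin n → Fin n} (h : ∀ q : Fin n, f q = F q) :
    IsImage n f U V ↔ V < 2 ^ n ∧ bitSet n V = F '' bitSet n U := by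
  refine and_congr_right fun _ => ?_
  rw [Set.ext_iff, Fin.forall_iff]
  refine forall₂_congr fun p hp => iff_congr Iff.rfl ⟨?_, ?_⟩
  · rintro ⟨q, hq, h1, h2⟩
    exact ⟨⟨q, hq⟩, h1, Fin.ext ((h ⟨q, hq⟩).symm.trans h2)⟩
  · rintro ⟨q, h1, h2⟩
    exact ⟨q, q.2, h1, (h q).trans (congrArg Fin.val h2)⟩

/-- The edges `DVPDA.FlatEdge` read off a description. -/
def FlatEdgeNum (x : List Bool) (U V : ℕ) : Prop :=
  (∃ a < numI x, IsImage (numQ x) (fun q => intQ x q a) U V) ∨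
    ∃ a < numR x, IsImage (numQ x) (fun q => retQ x q a 0) U V

/-- The edges `DVPDA.RiseEdge` read off a description. -/
def RiseEdgeNum (x : List Bool) (U V : ℕ) : Prop :=
  (∃ a < numI x, IsImage (numQ x) (fun q => intQ x q a) U V) ∨
    ∃ a < numC x, IsImage (numQ x) (fun q => callQ x q a) U V ∧
      ∀ p < numQ x, ∀ q < numQ x, U.testBit p = true → U.testBit q = true →
        callG x p a = callG x q a

/-- The description of an automaton with a `0`-turn synchronizing word. -/
def HasOneStrokeWord (x : List Bool) : Prop :=
  ∃ U < 2 ^ numQ x, ∃ p < numQ x,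
    Relation.ReflTransGen (FlatEdgeNum x) (2 ^ numQ x - 1) U ∧
    Relation.ReflTransGen (RiseEdgeNum x) U (2 ^ p)

/-! ### Agreement of the numerical conditions with those on the automaton -/

namespace CodedDVPDA

variable (M : CodedDVPDA)

theorem flatEdgeNum_encode (U V : ℕ) : FlatEdgeNum M.encode U V ↔
    V < 2 ^ M.nQ ∧ M.aut.FlatEdge (bitSet M.nQ U) (bitSet M.nQ V) := by
  rw [FlatEdgeNum, DVPDA.FlatEdge, numQ_encode, numI_encode, numR_encode, and_or_left,
    ← exists_and_left, ← exists_and_left, Fin.exists_iff, Fin.exists_iff]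
  simp only [← exists_prop (a := _ < _) (b := IsImage _ _ _ _)]
  refine or_congr (exists₂_congr fun a ha => isImage_iff fun q => M.intQ_encode q ⟨a, ha⟩)
    (exists₂_congr fun a ha => isImage_iff fun q => M.retQ_encode q ⟨a, ha⟩ (Nat.succ_pos _))

theorem riseEdgeNum_encode (U V : ℕ) : RiseEdgeNum M.encode U V ↔
    V < 2 ^ M.nQ ∧ M.aut.RiseEdge (bitSet M.nQ U) (bitSet M.nQ V) := by
  rw [RiseEdgeNum, DVPDA.RiseEdge, numQ_encode, numI_encode, numC_encode, and_or_left,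
    ← exists_and_left, ← exists_and_left, Fin.exists_iff, Fin.exists_iff]
  refine or_congr ?_ ?_
  · simp only [← exists_prop (a := _ < _) (b := IsImage _ _ _ _)]
    exact exists₂_congr fun a ha => isImage_iff fun q => M.intQ_encode q ⟨a, ha⟩
  · simp only [← exists_prop (a := _ < _) (b := IsImage _ _ _ _ ∧ _)]
    refine exists₂_congr fun a ha => ?_
    rw [isImage_iff fun q => M.callQ_encode q ⟨a, ha⟩, and_assoc]
    refine and_congr_right fun _ => and_congr_right fun _ => ⟨fun h p hp q hq => ?_,
      fun h p hp q hq hpU hqU => ?_⟩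
    · have := h p p.2 q q.2 hp hq
      rw [M.callG_encode p ⟨a, ha⟩, M.callG_encode q ⟨a, ha⟩] at this
      exact Fin.ext this
    · exact (M.callG_encode ⟨p, hp⟩ ⟨a, ha⟩).trans ((congrArg Fin.val (h ⟨p, hp⟩ hpU ⟨q, hq⟩ hqU)).trans
        (M.callG_encode ⟨q, hq⟩ ⟨a, ha⟩).symm)

theorem hasOneStrokeWord_encode :
    HasOneStrokeWord M.encode ↔ ∃ w, M.aut.TurnSyncSame 0 w := by
  rw [DVPDA.exists_turnSyncSame_zero_iff, HasOneStrokeWord, numQ_encode]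
  have hu : 2 ^ M.nQ - 1 < 2 ^ M.nQ := Nat.sub_lt (Nat.two_pow_pos _) Nat.one_pos
  constructor
  · rintro ⟨U, hU, p, hp, h1, h2⟩
    rw [reflTransGen_bitSet M.flatEdgeNum_encode hU hu, bitSet_two_pow_sub_one] at h1
    rw [reflTransGen_bitSet M.riseEdgeNum_encode (Nat.pow_lt_pow_right (by norm_num) hp) hU,
      bitSet_two_pow ⟨p, hp⟩] at h2
    exact ⟨_, _, h1, h2⟩
  · rintro ⟨S, p, h1, h2⟩
    obtain ⟨U, hU, rfl⟩ := exists_bitSet_eq S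
    refine ⟨U, hU, p, p.2, ?_, ?_⟩
    · rwa [reflTransGen_bitSet M.flatEdgeNum_encode hU hu, bitSet_two_pow_sub_one]
    · rwa [reflTransGen_bitSet M.riseEdgeNum_encode (Nat.pow_lt_pow_right (by norm_num) p.2) hU,
        bitSet_two_pow]

theorem isVeryVisibly_iff : M.aut.IsVeryVisibly ↔ ∀ a < numC M.encode, ∀ p < numQ M.encode,
    ∀ q < numQ M.encode, callG M.encode p a = callG M.encode q a := by
  rw [numC_encode, numQ_encode, DVPDA.IsVeryVisibly, Fin.forall_iff]
  refine forall₂_congr fun a ha => ?_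
  rw [Fin.forall_iff]
  refine forall₂_congr fun p hp => ?_
  rw [Fin.forall_iff]
  refine forall₂_congr fun q hq => ?_
  rw [M.callG_encode ⟨p, hp⟩ ⟨a, ha⟩, M.callG_encode ⟨q, hq⟩ ⟨a, ha⟩, Fin.ext_iff]

theorem isCounter_iff : M.aut.IsCounter ↔ numG M.encode = 1 := by
  rw [numG_encode, DVPDA.IsCounter, Nat.card_eq_fintype_card, Fintype.card_fin]

theorem noReturn_iff : M.aut.NoReturn ↔ numR M.encode = 0 := by
  rw [numR_encode, DVPDA.NoReturn, ← Fintype.card_eq_zero_iff, Fintype.card_fin]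

end CodedDVPDA

theorem mem_turnSyncSameProblem_zero_iff {P : CodedDVPDA → Prop} {P' : List Bool → Prop}
    (hP : ∀ M : CodedDVPDA, P M ↔ P' M.encode) (x : List Bool) :
    x ∈ TurnSyncSameProblem 0 P ↔ IsDescription x ∧ P' x ∧ HasOneStrokeWord x := by
  constructor
  · rintro ⟨M, hM, rfl, hw⟩
    exact ⟨M.isDescription_encode, (hP M).1 hM, M.hasOneStrokeWord_encode.2 hw⟩
  · rintro ⟨h1, h2, h3⟩
    have h4 := CodedDVPDA.encode_decode x h1
    exact ⟨.decode x h1, (hP _).2 (h4.symm ▸ h2), h4,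
      (CodedDVPDA.hasOneStrokeWord_encode _).1 (h4.symm ▸ h3)⟩

theorem syncSameProblem_noReturn : (SyncSameProblem fun M => M.aut.NoReturn) =
    TurnSyncSameProblem 0 fun M => M.aut.NoReturn := by
  refine Set.ext fun x => exists_congr fun M => and_congr_right fun hM =>
    and_congr_right fun _ => exists_congr fun w => (hM.turnSyncSame_zero_iff _ w).symm

/-! ### Reachability between sets of states in polynomial space -/

/-- A power of two fits into polynomial space only if its exponent is polynomially bounded. A
quantified exponent need not be, so it is truncated at `b`; `f - (f - b)` is the minimum. -/
theorem PS.two_pow_min {f b : α → ℕ} (hf : PS f) (hb : PS b) (hb' : PolyBound b) :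
    PS fun a => 2 ^ min (f a) (b a) :=
  PS.two_pow (((hf.sub (hf.sub hb))).of_enc fun a => by
    congr 1; omega) (hb'.of_le fun _ => Nat.min_le_right _ _)

/-- The conjunct `g a < b a` makes the truncation in `two_pow_min` harmless. -/
theorem PSP.lt_and_testBit {f g b : α → ℕ} (hf : PS f) (hg : PS g) (hb : PS b)
    (hb' : PolyBound b) : PSP fun a => g a < b a ∧ (f a).testBit (g a) = Bool.true :=
  ((PSP.lt hg hb).and (.eq ((hf.div (hg.two_pow_min hb hb')).mod (.const 2)) (.const 1))).of_iff
    fun a => and_congr_right fun h => by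
      rw [min_eq_left h.le]
      simp [Nat.testBit_eq_decide_div_mod_eq]

theorem PSP.isImage {n U V : α → ℕ} {f : α → ℕ → ℕ} (hn : PS n) (hn' : PolyBound n)
    (hf : PS fun x : α × ℕ => f x.1 x.2) (hU : PS U) (hV : PS V) :
    PSP fun a => IsImage (n a) (f a) (U a) (V a) := by
  have h1 : PSP fun x : α × ℕ => x.2 < n x.1 ∧ (V x.1).testBit x.2 = Bool.true :=
    .lt_and_testBit (hV.comp .fst) .snd (hn.comp .fst) (hn'.comp PS.fst.codeSize)
  have h2 : PSP fun x : (α × ℕ) × ℕ =>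
      (x.2 < n x.1.1 ∧ (U x.1.1).testBit x.2 = Bool.true) ∧ f x.1.1 x.2 = x.1.2 :=
    (PSP.lt_and_testBit (hU.comp (.fst' .fst)) .snd (hn.comp (.fst' .fst))
      (hn'.comp (PS.fst' .fst).codeSize)).and
        (.eq (hf.comp (.pair (.fst' .fst) .snd)) (.snd' .fst))
  have h3 := PSP.exists_lt (p := fun (x : α × ℕ) q =>
    (q < n x.1 ∧ (U x.1).testBit q = Bool.true) ∧ f x.1 q = x.2) (hn.comp .fst) h2
  refine ((PSP.lt hV (hn.two_pow hn')).and (PSP.forall_lt (p := fun a p =>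
    p < n a ∧ (V a).testBit p = Bool.true ↔ ∃ q < n a,
      (q < n a ∧ (U a).testBit q = Bool.true) ∧ f a q = p) hn (h1.iff h3))).of_iff fun a => ?_
  refine and_congr_right fun _ => forall₂_congr fun p hp => ?_
  simp only [hp, true_and]
  refine iff_congr Iff.rfl (exists_congr fun q => and_congr_right fun hq => ?_)
  simp only [hq, true_and]

theorem PS.numQ : PS numQ := .num .id (.const 0)
theorem PS.numC : PS numC := .num .id (.const 1)
theorem PS.numI : PS numI := .num .id (.const 2)
theorem PS.numR : PS numR := .num .id (.const 3)
theorem PS.numG : PS numG := .num .id (.const 4)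

/-- The unary notation enters here: there are at most as many states as the description is long, so
sets of states have polynomially many bits and Savitch's recursion has polynomial depth. -/
theorem PolyBound.numQ : PolyBound numQ := PolyBound.codeSize.of_le fun x => num_le_codeSize x 0

theorem PS.callQ {x : α → List Bool} {q a : α → ℕ} (hx : PS x) (hq : PS q) (ha : PS a) :
    PS fun s => callQ (x s) (q s) (a s) :=
  .num hx ((PS.const 5).add ((hq.mul ((PS.numC.comp hx).mul (.const 2))).add
    ((ha.mul (.const 2)).add (.const 0))))

theorem PS.callG {x : α → List Bool} {q a : α → ℕ} (hx : PS x) (hq : PS q) (ha : PS a) :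
    PS fun s => callG (x s) (q s) (a s) :=
  .num hx ((PS.const 5).add ((hq.mul ((PS.numC.comp hx).mul (.const 2))).add
    ((ha.mul (.const 2)).add (.const 1))))

theorem PS.intQ {x : α → List Bool} {q a : α → ℕ} (hx : PS x) (hq : PS q) (ha : PS a) :
    PS fun s => intQ (x s) (q s) (a s) :=
  .num hx (((PS.const 5).add ((PS.numQ.comp hx).mul ((PS.numC.comp hx).mul (.const 2)))).add
    ((hq.mul (PS.numI.comp hx)).add ha))

theorem PS.retQ {x : α → List Bool} {q a j : α → ℕ} (hx : PS x) (hq : PS q) (ha : PS a)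
    (hj : PS j) : PS fun s => retQ (x s) (q s) (a s) (j s) :=
  .num hx ((((PS.const 5).add ((PS.numQ.comp hx).mul ((PS.numC.comp hx).mul (.const 2)))).add
    ((PS.numQ.comp hx).mul (PS.numI.comp hx))).add
    ((hq.mul ((PS.numR.comp hx).mul ((PS.numG.comp hx).add (.const 1)))).add
      ((ha.mul ((PS.numG.comp hx).add (.const 1))).add hj)))

/-- Universal quantification over two bounded numbers. -/
theorem PSP.forall_lt_lt {m n : α → ℕ} {p : α → ℕ → ℕ → Prop} (hm : PS m) (hn : PS n)
    (hp : PSP fun x : (α × ℕ) × ℕ => p x.1.1 x.1.2 x.2) :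
    PSP fun a => ∀ i < m a, ∀ j < n a, p a i j :=
  .forall_lt (p := fun a i => ∀ j < n a, p a i j) hm
    (.forall_lt (p := fun x : α × ℕ => p x.1 x.2) (hn.comp .fst) hp)

theorem PSP.isDescription : PSP IsDescription := by
  have hq : PS fun s : (List Bool × ℕ) × ℕ => s.1.1 := .fst' .fst
  have hi : PS fun s : (List Bool × ℕ) × ℕ => s.1.2 := .snd' .fst
  have hj : PS fun s : (List Bool × ℕ) × ℕ => s.2 := .snd
  refine .and (.isNums .id ?_) (.and ?_ (.and ?_ ?_))
  · exact (((PS.const 5).add (PS.numQ.mul (PS.numC.mul (.const 2)))).add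
      (PS.numQ.mul PS.numI)).add (PS.numQ.mul (PS.numR.mul (PS.numG.add (.const 1))))
  · exact .forall_lt_lt (p := fun x q a => _root_.callQ x q a < _root_.numQ x ∧
        _root_.callG x q a < _root_.numG x) PS.numQ PS.numC
      ((PSP.lt (.callQ hq hi hj) (PS.numQ.comp hq)).and (.lt (.callG hq hi hj) (PS.numG.comp hq)))
  · exact .forall_lt_lt (p := fun x q a => _root_.intQ x q a < _root_.numQ x) PS.numQ PS.numI
      (PSP.lt (.intQ hq hi hj) (PS.numQ.comp hq))
  · refine .forall_lt_lt (p := fun x q a => ∀ j < _root_.numG x + 1,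
      _root_.retQ x q a j < _root_.numQ x) PS.numQ PS.numR
      (PSP.forall_lt (p := fun (s : (List Bool × ℕ) × ℕ) j => _root_.retQ s.1.1 s.1.2 s.2 j <
        _root_.numQ s.1.1) ((PS.numG.comp hq).add (.const 1)) ?_)
    exact .lt (.retQ (hq.comp .fst) (hi.comp .fst) (hj.comp .fst) .snd) (PS.numQ.comp (hq.comp .fst))

theorem PSP.intEdge : PSP fun y : List Bool × ℕ × ℕ =>
    ∃ a < numI y.1, IsImage (numQ y.1) (fun q => intQ y.1 q a) y.2.1 y.2.2 :=
  .exists_lt (p := fun (y : List Bool × ℕ × ℕ) a =>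
      IsImage (_root_.numQ y.1) (fun q => _root_.intQ y.1 q a) y.2.1 y.2.2) (PS.numI.comp .fst)
    (.isImage (PS.numQ.comp (.fst' .fst)) (PolyBound.numQ.comp (PS.fst' .fst).codeSize)
      (.intQ (.fst' (.fst' .fst)) .snd (.snd' .fst)) (.fst' (.snd' .fst)) (.snd' (.snd' .fst)))

theorem PSP.flatEdgeNum : PSP fun y : List Bool × ℕ × ℕ => FlatEdgeNum y.1 y.2.1 y.2.2 :=
  PSP.intEdge.or (.exists_lt (p := fun (y : List Bool × ℕ × ℕ) a =>
      IsImage (_root_.numQ y.1) (fun q => _root_.retQ y.1 q a 0) y.2.1 y.2.2) (PS.numR.comp .fst)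
    (.isImage (PS.numQ.comp (.fst' .fst)) (PolyBound.numQ.comp (PS.fst' .fst).codeSize)
      (.retQ (.fst' (.fst' .fst)) .snd (.snd' .fst) (.const 0)) (.fst' (.snd' .fst))
      (.snd' (.snd' .fst))))

theorem PSP.riseEdgeNum : PSP fun y : List Bool × ℕ × ℕ => RiseEdgeNum y.1 y.2.1 y.2.2 := by
  refine PSP.intEdge.or (.exists_lt (p := fun (y : List Bool × ℕ × ℕ) a =>
      IsImage (_root_.numQ y.1) (fun q => _root_.callQ y.1 q a) y.2.1 y.2.2 ∧
      ∀ p < _root_.numQ y.1, ∀ q < _root_.numQ y.1, y.2.1.testBit p = Bool.true →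
        y.2.1.testBit q = Bool.true → _root_.callG y.1 p a = _root_.callG y.1 q a)
    (PS.numC.comp .fst) (.and
    (.isImage (PS.numQ.comp (.fst' .fst)) (PolyBound.numQ.comp (PS.fst' .fst).codeSize)
      (.callQ (.fst' (.fst' .fst)) .snd (.snd' .fst)) (.fst' (.snd' .fst))
      (.snd' (.snd' .fst))) ?_))
  have hx : PS fun z : (((List Bool × ℕ × ℕ) × ℕ) × ℕ) × ℕ => z.1.1.1.1 :=
    .fst' (.fst' (.fst' .fst))
  have hU : PS fun z : (((List Bool × ℕ × ℕ) × ℕ) × ℕ) × ℕ => z.1.1.1.2.1 :=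
    .fst' (.snd' (.fst' (.fst' .fst)))
  have ha : PS fun z : (((List Bool × ℕ × ℕ) × ℕ) × ℕ) × ℕ => z.1.1.2 := .snd' (.fst' .fst)
  have hp : PS fun z : (((List Bool × ℕ × ℕ) × ℕ) × ℕ) × ℕ => z.1.2 := .snd' .fst
  have hq : PS fun z : (((List Bool × ℕ × ℕ) × ℕ) × ℕ) × ℕ => z.2 := .snd
  have hn := PS.numQ.comp hx
  have hn' := PolyBound.numQ.comp hx.codeSize
  refine (PSP.forall_lt_lt (p := fun (y : (List Bool × ℕ × ℕ) × ℕ) p q =>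
    (p < _root_.numQ y.1.1 ∧ y.1.2.1.testBit p = Bool.true) →
      (q < _root_.numQ y.1.1 ∧ y.1.2.1.testBit q = Bool.true) →
      _root_.callG y.1.1 p y.2 = _root_.callG y.1.1 q y.2)
    (PS.numQ.comp (.fst' .fst)) (PS.numQ.comp (.fst' .fst))
    ((PSP.lt_and_testBit hU hp hn hn').imp ((PSP.lt_and_testBit hU hq hn hn').imp
      (.eq (.callG hx hp ha) (.callG hx hq ha))))).of_iff fun y => ?_
  refine forall₂_congr fun p hp => forall₂_congr fun q hq => ?_
  simp only [hp, hq, true_and]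

theorem PSP.reach {E : List Bool → ℕ → ℕ → Prop}
    (hE : PSP fun y : List Bool × ℕ × ℕ => E y.1 y.2.1 y.2.2)
    (hEN : ∀ x u v, E x u v → v < 2 ^ numQ x) {x : α → List Bool} {u v : α → ℕ} (hx : PS x)
    (hu : PS u) (hv : PS v) : PSP fun a => u a < 2 ^ numQ (x a) ∧ v a < 2 ^ numQ (x a) ∧
      Relation.ReflTransGen (E (x a)) (u a) (v a) :=
  (PSP.reflTransGen (N := fun x => 2 ^ _root_.numQ x) (PS.numQ.two_pow .numQ) PS.numQ .numQ
    (fun _ => le_rfl) (fun _ => Nat.two_pow_pos _) hE hEN).comp (.pair hx (.pair hu hv))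

theorem FlatEdgeNum.lt {x : List Bool} {U V : ℕ} (h : FlatEdgeNum x U V) : V < 2 ^ numQ x := by
  rcases h with ⟨a, _, h⟩ | ⟨a, _, h⟩ <;> exact h.1

theorem RiseEdgeNum.lt {x : List Bool} {U V : ℕ} (h : RiseEdgeNum x U V) : V < 2 ^ numQ x := by
  rcases h with ⟨a, _, h⟩ | ⟨a, _, h, _⟩ <;> exact h.1

theorem PSP.hasOneStrokeWord : PSP HasOneStrokeWord := by
  have hx : PS fun z : (List Bool × ℕ) × ℕ => z.1.1 := .fst' .fst
  have hU : PS fun z : (List Bool × ℕ) × ℕ => z.1.2 := .snd' .fst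
  have hn := PS.numQ.comp hx
  have hn' := PolyBound.numQ.comp hx.codeSize
  have h1 := PSP.reach .flatEdgeNum (fun _ _ _ h => h.lt) hx ((hn.two_pow hn').sub (.const 1)) hU
  have h2 := PSP.reach .riseEdgeNum (fun _ _ _ h => h.lt) hx hU
    (PS.two_pow_min .snd hn hn')
  -- The range conditions and the truncated exponent come from `PSP.reach` and `two_pow_min`; they
  -- are void for `U < 2 ^ numQ x` and `p < numQ x`.
  let A (x : List Bool) (U p : ℕ) : Prop :=
    (2 ^ _root_.numQ x - 1 < 2 ^ _root_.numQ x ∧ U < 2 ^ _root_.numQ x ∧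
      Relation.ReflTransGen (FlatEdgeNum x) (2 ^ _root_.numQ x - 1) U) ∧
    U < 2 ^ _root_.numQ x ∧ 2 ^ min p (_root_.numQ x) < 2 ^ _root_.numQ x ∧
      Relation.ReflTransGen (RiseEdgeNum x) U (2 ^ min p (_root_.numQ x))
  have h3 : PSP fun z : (List Bool × ℕ) × ℕ => A z.1.1 z.1.2 z.2 := h1.and h2
  refine (PSP.exists_lt (p := fun x U => ∃ p < _root_.numQ x, A x U p) (PS.numQ.two_pow .numQ)
    (PSP.exists_lt (p := fun (y : List Bool × ℕ) p => A y.1 y.2 p) (PS.numQ.comp .fst) h3)).of_iff fun x => ?_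
  refine exists_congr fun U => and_congr_right fun hU => exists_congr fun p =>
    and_congr_right fun hp => ?_
  simp only [A, min_eq_left (le_of_lt hp), hU, true_and, Nat.sub_lt (Nat.two_pow_pos _) Nat.one_pos,
    Nat.pow_lt_pow_right (le_refl 2) hp]

/-! ### The decision problems -/

theorem inPSPACE_turnSyncSameProblem_zero {P : CodedDVPDA → Prop} {P' : List Bool → Prop}
    (hP : ∀ M : CodedDVPDA, P M ↔ P' M.encode) (hP' : PSP P') :
    InPSPACE (TurnSyncSameProblem 0 P) :=
  ((PSP.isDescription.and (hP'.and .hasOneStrokeWord)).of_iff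
    (mem_turnSyncSameProblem_zero_iff hP)).inPSPACE

theorem PSP.callG_eq : PSP fun x : List Bool => ∀ a < numC x, ∀ p < numQ x, ∀ q < numQ x,
    callG x p a = callG x q a := by
  refine .forall_lt_lt (p := fun x a p => ∀ q < _root_.numQ x,
    _root_.callG x p a = _root_.callG x q a) PS.numC PS.numQ (.forall_lt
      (p := fun (y : (List Bool × ℕ) × ℕ) q => _root_.callG y.1.1 y.2 y.1.2 =
        _root_.callG y.1.1 q y.1.2) (PS.numQ.comp (.fst' .fst)) ?_)
  exact .eq (.callG (.fst' (.fst' .fst)) (.snd' .fst) (.snd' (.fst' .fst)))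
    (.callG (.fst' (.fst' .fst)) .snd (.snd' (.fst' .fst)))

/-- The problems 0-Turn-Sync-{DVPDA, DVVPDA, DVCA}-Same and Sync-DVPDA-Same-NoReturn are in
PSPACE. -/
theorem mainTheorem9 :
    InPSPACE (TurnSyncSameProblem 0 fun _ => True) ∧
    InPSPACE (TurnSyncSameProblem 0 fun M => M.aut.IsVeryVisibly) ∧
    InPSPACE (TurnSyncSameProblem 0 fun M => M.aut.IsCounter) ∧
    InPSPACE (SyncSameProblem fun M => M.aut.NoReturn) := by
  refine ⟨inPSPACE_turnSyncSameProblem_zero (fun _ => Iff.rfl) .true,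
    inPSPACE_turnSyncSameProblem_zero CodedDVPDA.isVeryVisibly_iff .callG_eq,
    inPSPACE_turnSyncSameProblem_zero CodedDVPDA.isCounter_iff (.eq .numG (.const 1)), ?_⟩
  rw [syncSameProblem_noReturn]
  exact inPSPACE_turnSyncSameProblem_zero CodedDVPDA.noReturn_iff (.eq .numR (.const 0))
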